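/- All graphs are finite, simple and undirected (not necessarily connected), and $P_m$ denotes the path on $m$ vertices; a graph is $P_m$-free if it has no induced subgraph isomorphic to $P_m$. Fix $c \in \mathbb{N}$. In an $n$-vertex network the vertices carry pairwise distinct identifiers from $\{1,\dots,n^c\}$. A certificate is a finite bit string attached to a vertex; its size is its length. The view at distance $d$ of a vertex $v$ consists of the identifier of $v$, the vertices at distance at most $d$ from $v$, each given by its identifier and its certificate, and the edges between these vertices, except those joining two vertices at distance exactly $d$ from $v$. A graph property $\mathcal{P}$ has a local certification of size $s : \mathbb{N} \to \mathbb{N}$ with verification radius $d$ if there is a verification algorithm, i.e. a map from views at distance $d$ to $\{\text{accept}, \text{reject}\}$ (the same for all networks; it is not given $n$), such that for every $n \in \mathbb{N}$, every $n$-vertex graph $G$ and every assignment of identifiers as above: - if $G$ satisfies $\mathcal{P}$, then there is an assignment of certificates of size at most $s(n)$ for which every vertex accepts; - if $G$ does not satisfy $\mathcal{P}$, then for every assignment of certificates (of any size) at least one vertex rejects. **Theorem.** For every $c \in \mathbb{N}$ there is a function $s : \mathbb{N} \to \mathbb{N}$ with $s(n) = O(n^{3/2} \log^2 n)$ as $n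 \to \infty$ such that, for every integer $k \ge 1$, the property of being $P_{4k-1}$-free has a local certification of size $s$ with verification radius $k$. (In particular the constant in the $O$ does not depend on $k$.) -/

import Mathlib

/-- A property of (simple, undirected) graphs; it is only ever evaluated on finite graphs. -/
abbrev GraphProperty : Type 1 := ∀ V : Type, SimpleGraph V → Prop

/-- `G` is `P_m`-free: it has no induced subgraph isomorphic to the path on `m` vertices. -/
def IsInducedPathFree (m : ℕ) : GraphProperty :=
  fun _ G => ¬ (SimpleGraph.pathGraph m).IsIndContained G

/-- What a node gets to see: its own identifier, the identifiers and certificates (bit strings) of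
the visible vertices, and the visible edges, written as ordered pairs of identifiers in both
orders.  Neither the number of vertices of the network nor the vertices themselves are part
of it. -/
@[ext]
structure LocalView where
  center : ℕ
  labels : Set (ℕ × List Bool)
  edges : Set (ℕ × ℕ)

/-- The view at distance `d` of the vertex `v`: the vertices at distance at most `d` from `v`, with
their identifiers and certificates, and the edges between these vertices, except the ones between
two vertices at distance exactly `d`. The distance `edist` is infinite between vertices in
different connected components. -/
def localView {V : Type} (G : SimpleGraph V) (ident : V → ℕ) (cert : V → List Bool) (d : ℕ)
    (v : V) : LocalView where
  center := ident v
  labels := {p | ∃ w, G.edist v w ≤ d ∧ p = (ident w, cert w)}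
  edges := {p | ∃ a b, G.Adj a b ∧ G.edist v a ≤ d ∧ G.edist v b ≤ d ∧
    ¬ (G.edist v a = d ∧ G.edist v b = d) ∧ p = (ident a, ident b)}

/-- The vertices carry pairwise distinct identifiers in `{1, …, n ^ c}`, where `n` is the number of
vertices, that is, unique identifiers on `O(log n)` bits. -/
def IsIdentifierAssignment (c : ℕ) {V : Type} [Fintype V] (ident : V → ℕ) : Prop :=
  Function.Injective ident ∧ ∀ v, 1 ≤ ident v ∧ ident v ≤ Fintype.card V ^ c

/-- There is a local certification of size `s` with verification radius `d` for the property `P`,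
on networks whose identifiers range in `{1, …, n ^ c}`. One verification algorithm, a function of
the view alone (`true` is accept and `false` is reject), serves all networks. -/
def HasLocalCertification (c : ℕ) (s : ℕ → ℕ) (d : ℕ) (P : GraphProperty) : Prop :=
  ∃ verify : LocalView → Bool,
    ∀ (V : Type) [Fintype V] (G : SimpleGraph V) (ident : V → ℕ), IsIdentifierAssignment c ident →
      (P V G → ∃ cert : V → List Bool, (∀ v, (cert v).length ≤ s (Fintype.card V)) ∧
        ∀ v, verify (localView G ident cert d v) = true) ∧
      (¬ P V G → ∀ cert : V → List Bool, ∃ v, verify (localView G ident cert d v) = false)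

/-! ### Self-delimiting binary codes -/

/-! Call a vertex high if its degree is at least q = ⌊√n⌋, and put κ = k - 1. For k ≥ 2, join two
high vertices when some vertex is within distance κ of both; the components of this relation are the
clusters. Distinct clusters are at distance at least 2k - 1 and have disjoint neighbourhoods, so
there are O(√n) of them. Every vertex can therefore be given, in O(n^(3/2)) facts, all adjacency
lists of low vertices, the distances to every cluster, and a spanning tree of each cluster.

The other adjacency lists are split into about √n / log n balanced classes, and each vertex stores
one class, its colour. By a union bound some colouring shows every colour in the neighbourhood of
every high vertex (`exists_coloring_surjOn`), so a high vertex can read all lists from its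
neighbours. To authenticate them, each high vertex checks its own list, and for each tree edge a
vertex within κ of both ends compares what the two ends read. Hence all of a cluster reads the same,
correct lists for its members (`Sees.reads_iff_adj`), and a vertex knows every edge except those
inside foreign clusters (`Sees.knownAdj_iff`).

An induced path on 4k - 1 vertices escapes each vertex on it only by meeting a cluster foreign to
that vertex twice. Thus it meets two clusters A and B twice each, and for lack of length no third
one, and one after the other. Along it the distance to B changes by at most one per step, and
counting yields a level passed exactly once, farther vertices before and nearer ones after
(`exists_unique_crossing`). The certificates record, for each cluster B and vertex v, the longest
induced path from v that afterwards stays strictly closer to B. Vertices of B check this for the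
second part of the path, vertices of A add the first part, and the long path is detected. Conversely
two such parts always concatenate to an induced path (`IsInducedPath.append`), so honest
certificates of a good graph are accepted.

For k = 1 the graphs are disjoint unions of complete graphs, and closed neighbourhoods serve as
certificates. -/

theorem Nat.foldr_bit_bits (n : ℕ) : n.bits.foldr Nat.bit 0 = n := by
  induction n using Nat.binaryRec' with
  | zero => simp
  | bit b n h ih => rw [Nat.bits_append_bit n b h, List.foldr_cons, ih]

theorem Nat.bits_injective : Function.Injective Nat.bits :=
  fun m n h => by rw [← Nat.foldr_bit_bits m, ← Nat.foldr_bit_bits n, h]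

/-- A prefix code for bit strings: each bit is preceded by a continuation mark. -/
def bitCode : List Bool → List Bool
  | [] => [false]
  | b :: l => true :: b :: bitCode l

theorem length_bitCode (l : List Bool) : (bitCode l).length = 2 * l.length + 1 := by
  induction l with
  | nil => rfl
  | cons b l ih => simp only [bitCode, List.length_cons, ih]; ring

theorem bitCode_append_inj {l l' r r' : List Bool} (h : bitCode l ++ r = bitCode l' ++ r') :
    l = l' ∧ r = r' := by
  induction l generalizing l' with
  | nil => cases l' <;> simp_all [bitCode]
  | cons b l ih =>
    cases l' with
    | nil => simp [bitCode] at h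
    | cons b' l' =>
      simp only [bitCode, List.cons_append, List.cons.injEq, true_and] at h
      obtain ⟨h1, h2⟩ := ih h.2
      exact ⟨by rw [h.1, h1], h2⟩

/-- A prefix code for quadruples of natural numbers. -/
def quadCode (p : ℕ × ℕ × ℕ × ℕ) : List Bool :=
  bitCode p.1.bits ++ (bitCode p.2.1.bits ++ (bitCode p.2.2.1.bits ++ bitCode p.2.2.2.bits))

theorem quadCode_append_inj {p p' : ℕ × ℕ × ℕ × ℕ} {r r' : List Bool}
    (h : quadCode p ++ r = quadCode p' ++ r') : p = p' ∧ r = r' := by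
  simp only [quadCode, List.append_assoc] at h
  obtain ⟨h1, h⟩ := bitCode_append_inj h
  obtain ⟨h2, h⟩ := bitCode_append_inj h
  obtain ⟨h3, h⟩ := bitCode_append_inj h
  obtain ⟨h4, h⟩ := bitCode_append_inj h
  refine ⟨?_, h⟩
  ext
  exacts [Nat.bits_injective h1, Nat.bits_injective h2, Nat.bits_injective h3,
    Nat.bits_injective h4]

theorem length_quadCode_le {p : ℕ × ℕ × ℕ × ℕ} {s : ℕ} (h1 : p.1 < 2 ^ s) (h2 : p.2.1 < 2 ^ s)
    (h3 : p.2.2.1 < 2 ^ s) (h4 : p.2.2.2 < 2 ^ s) : (quadCode p).length ≤ 8 * s + 4 := by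
  rw [← Nat.size_le, ← Nat.size_eq_bits_len] at h1 h2 h3 h4
  simp only [quadCode, List.length_append, length_bitCode]
  omega

theorem flatMap_quadCode_injective :
    Function.Injective fun l : List (ℕ × ℕ × ℕ × ℕ) => l.flatMap quadCode := by
  intro l l' h
  have pos : ∀ p, quadCode p ≠ [] := fun p hp => by
    have := congrArg List.length hp
    simp [quadCode, length_bitCode] at this
  induction l generalizing l' with
  | nil =>
    cases l' with
    | nil => rfl
    | cons p l' => simp [pos] at h
  | cons p l ih =>
    cases l' with
    | nil => simp [pos] at h
    | cons p' l' =>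
      simp only [List.flatMap_cons] at h
      obtain ⟨h1, h2⟩ := quadCode_append_inj h
      rw [h1, ih h2]

/-- A finite set of facts, each a tag followed by two arguments and a value. -/
abbrev FactSet := Finset (ℕ × ℕ × ℕ × ℕ)

/-! ### Fact sets as bit strings -/

namespace FactSet

noncomputable def encode (F : FactSet) : List Bool := F.toList.flatMap quadCode

theorem encode_injective : Function.Injective encode := fun F F' h => by
  rw [← Finset.toList_toFinset F, ← Finset.toList_toFinset F', flatMap_quadCode_injective h]

/-- An inverse by choice is enough: a verification algorithm may be any function of the view. -/
noncomputable def decode : List Bool → FactSet := Function.invFun encode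

theorem decode_encode (F : FactSet) : decode (encode F) = F :=
  Function.leftInverse_invFun encode_injective F

theorem length_encode_le {F : FactSet} {s : ℕ}
    (h : ∀ p ∈ F, p.1 < 2 ^ s ∧ p.2.1 < 2 ^ s ∧ p.2.2.1 < 2 ^ s ∧ p.2.2.2 < 2 ^ s) :
    (encode F).length ≤ F.card * (8 * s + 4) := by
  rw [encode, List.length_flatMap, ← Finset.length_toList]
  refine (List.sum_le_card_nsmul _ (8 * s + 4) ?_).trans (by simp)
  intro x hx
  obtain ⟨p, hp, rfl⟩ := List.mem_map.1 hx
  obtain ⟨h1, h2, h3, h4⟩ := h p (Finset.mem_toList.1 hp)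
  exact length_quadCode_le h1 h2 h3 h4

/-- The value that `F` records for a tag and two arguments. -/
def val (F : FactSet) (t a b : ℕ) : ℕ :=
  -- The supremum makes the lookup total. Its value 0 on a missing record serves below as "no such
  -- vertex", "infinite distance" and "no path".
  (F.filter fun p => p.1 = t ∧ p.2.1 = a ∧ p.2.2.1 = b).sup fun p => p.2.2.2

theorem val_eq {F : FactSet} {t a b v : ℕ} (h : ∀ w, (t, a, b, w) ∈ F ↔ w = v) :
    F.val t a b = v := by
  have : (F.filter fun p => p.1 = t ∧ p.2.1 = a ∧ p.2.2.1 = b) = {(t, a, b, v)} := by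
    ext ⟨t', a', b', w⟩
    simp only [Finset.mem_filter, Finset.mem_singleton, Prod.mk.injEq]
    constructor
    · rintro ⟨hF, rfl, rfl, rfl⟩
      exact ⟨rfl, rfl, rfl, (h w).1 hF⟩
    · rintro ⟨rfl, rfl, rfl, rfl⟩
      exact ⟨(h w).2 rfl, rfl, rfl, rfl⟩
  rw [val, this, Finset.sup_singleton]

theorem val_eq_zero {F : FactSet} {t a b : ℕ} (h : ∀ w, (t, a, b, w) ∉ F) : F.val t a b = 0 := by
  have : (F.filter fun p => p.1 = t ∧ p.2.1 = a ∧ p.2.2.1 = b) = ∅ := by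
    ext ⟨t', a', b', w⟩
    simp only [Finset.mem_filter, Finset.notMem_empty, iff_false]
    rintro ⟨hF, rfl, rfl, rfl⟩
    exact h _ hF
  rw [val, this]
  rfl

/-- The facts that all vertices of a component are supposed to share. -/
def common (F : FactSet) : FactSet := F.filter fun p => p.1 < 7

end FactSet

/-! ### Colorings that are onto on all large sets -/

/-- Bernoulli: (1 + 1/(m-1))^m ≥ 1 + m/(m-1) ≥ 2 for m ≥ 2. -/
theorem two_mul_pow_pred_le {m : ℕ} (hm : 0 < m) : 2 * (m - 1) ^ m ≤ m ^ m := by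
  rcases m with _ | _ | m
  · exact absurd hm (lt_irrefl 0)
  · simp
  have h := one_add_mul_le_pow (R := ℚ) (a := 1 / (m + 1 : ℚ)) (by
    have : (0 : ℚ) ≤ 1 / (m + 1 : ℚ) := by positivity
    linarith) (m + 2)
  have h2 : (2 : ℚ) ≤ (1 + 1 / (m + 1 : ℚ)) ^ (m + 2) := by
    refine le_trans ?_ h
    have : (m + 1 : ℚ) * (1 / (m + 1)) = 1 := by field_simp
    have h0 : (0 : ℚ) ≤ 1 / (m + 1 : ℚ) := by positivity
    push_cast
    nlinarith
  have h3 : (1 + 1 / (m + 1 : ℚ)) = (m + 2) / (m + 1) := by field_simp; ring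
  rw [h3, div_pow, le_div_iff₀ (by positivity)] at h2
  have : (2 * (m + 1) ^ (m + 2) : ℚ) ≤ (m + 2) ^ (m + 2) := h2
  simp only [Nat.add_sub_cancel]
  exact_mod_cast this

/-- Union bound over the pairs (u, i): at most (m-1)^d m^(n-d) colourings avoid the colour i on `S
u`, since d of its vertices lose one choice. By `hm` the bad colourings number fewer than m^n. -/
theorem exists_coloring_surjOn {V : Type*} [Fintype V] {m d : ℕ} (hm0 : 0 < m) (H : Finset V)
    (S : V → Finset V) (hS : ∀ u ∈ H, d ≤ (S u).card)
    (hm : Fintype.card V * m * (m - 1) ^ d < m ^ d) :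
    ∃ φ : V → Fin m, ∀ u ∈ H, ∀ i, ∃ w ∈ S u, φ w = i := by
  classical
  by_contra! hcon
  have hbad : (Finset.univ : Finset (V → Fin m)) ⊆
      (H ×ˢ (Finset.univ : Finset (Fin m))).biUnion fun p =>
        Finset.univ.filter fun φ => ∀ w ∈ S p.1, φ w ≠ p.2 := by
    intro φ _
    obtain ⟨u, hu, i, hi⟩ := hcon φ
    simp only [Finset.mem_biUnion, Finset.mem_product, Finset.mem_univ, and_true,
      Finset.mem_filter, true_and, Prod.exists]
    exact ⟨u, i, hu, hi⟩
  have hcard : ∀ u ∈ H, ∀ i : Fin m,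
      (Finset.univ.filter fun φ : V → Fin m => ∀ w ∈ S u, φ w ≠ i).card * m ^ d ≤
        (m - 1) ^ d * m ^ Fintype.card V := by
    intro u hu i
    obtain ⟨D, hD, hDc⟩ := Finset.exists_subset_card_eq (hS u hu)
    have hsub : (Finset.univ.filter fun φ : V → Fin m => ∀ w ∈ S u, φ w ≠ i) ⊆
        Fintype.piFinset fun w => if w ∈ D then Finset.univ.erase i else Finset.univ := by
      intro φ hφ
      simp only [Finset.mem_filter, Finset.mem_univ, true_and] at hφ
      rw [Fintype.mem_piFinset]
      intro w
      split_ifs with hw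
      · simpa using hφ w (hD hw)
      · simp
    have h1 := Finset.card_le_card hsub
    rw [Fintype.card_piFinset] at h1
    have h2 : ∏ w : V, (if w ∈ D then Finset.univ.erase i else (Finset.univ : Finset (Fin m))).card
        = (m - 1) ^ d * m ^ (Fintype.card V - d) := by
      have : ∀ w : V, (if w ∈ D then Finset.univ.erase i else (Finset.univ : Finset (Fin m))).card
          = if w ∈ D then m - 1 else m := fun w => by
        split_ifs
        · rw [Finset.card_erase_of_mem (Finset.mem_univ _)]; simp
        · simp
      rw [Finset.prod_congr rfl fun w _ => this w, Finset.prod_ite]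
      simp only [Finset.prod_const]
      have hf : (Finset.univ.filter fun w => w ∈ D) = D := by ext; simp
      have hg : (Finset.univ.filter fun w => w ∉ D) = Dᶜ := by ext; simp
      rw [hf, hg, Finset.card_compl, hDc]
    rw [h2] at h1
    have hdn : d ≤ Fintype.card V := hDc ▸ Finset.card_le_univ D
    calc _ ≤ (m - 1) ^ d * m ^ (Fintype.card V - d) * m ^ d := Nat.mul_le_mul_right _ h1
      _ = _ := by rw [mul_assoc, ← pow_add, Nat.sub_add_cancel hdn]
  have h1 := Finset.card_le_card hbad
  have h2 : m ^ Fintype.card V * m ^ d ≤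
      (Fintype.card V * m) * ((m - 1) ^ d * m ^ Fintype.card V) := by
    rw [Finset.card_univ, Fintype.card_fun, Fintype.card_fin] at h1
    calc _ ≤ (∑ p ∈ H ×ˢ (Finset.univ : Finset (Fin m)),
          (Finset.univ.filter fun φ : V → Fin m => ∀ w ∈ S p.1, φ w ≠ p.2).card) * m ^ d :=
          Nat.mul_le_mul_right _ (h1.trans Finset.card_biUnion_le)
      _ = ∑ p ∈ H ×ˢ (Finset.univ : Finset (Fin m)),
          (Finset.univ.filter fun φ : V → Fin m => ∀ w ∈ S p.1, φ w ≠ p.2).card * m ^ d :=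
          Finset.sum_mul ..
      _ ≤ (H ×ˢ (Finset.univ : Finset (Fin m))).card • ((m - 1) ^ d * m ^ Fintype.card V) :=
          Finset.sum_le_card_nsmul _ _ _ fun p hp => hcard p.1 (Finset.mem_product.1 hp).1 p.2
      _ ≤ _ := by
          rw [smul_eq_mul, Finset.card_product, Finset.card_univ, Fintype.card_fin]
          gcongr
          exact Finset.card_le_univ H
  have h3 : (Fintype.card V * m * (m - 1) ^ d) * m ^ Fintype.card V <
      m ^ d * m ^ Fintype.card V := Nat.mul_lt_mul_of_pos_right hm (by positivity)
  have e1 : (Fintype.card V * m) * ((m - 1) ^ d * m ^ Fintype.card V) =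
    (Fintype.card V * m * (m - 1) ^ d) * m ^ Fintype.card V := by ring
  rw [mul_comm (m ^ d), ← e1] at h3
  omega

/-! ### Integer sequences with small steps -/

/-- A discrete intermediate value theorem: a descent by at most one per step skips no level. -/
theorem exists_eq_of_steps {h : ℕ → ℕ} {a b D : ℕ} (hab : a ≤ b)
    (hstep : ∀ i, a ≤ i → i < b → h i ≤ h (i + 1) + 1) (ha : D ≤ h a) (hb : h b ≤ D) :
    ∃ i, a ≤ i ∧ i ≤ b ∧ h i = D := by
  induction b, hab using Nat.le_induction with
  | base => exact ⟨a, le_rfl, le_rfl, le_antisymm hb ha⟩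
  | succ b hab ih =>
    by_cases hbD : h b ≤ D
    · obtain ⟨i, h1, h2, h3⟩ := ih (fun i h1 h2 => hstep i h1 (by omega)) hbD
      exact ⟨i, h1, by omega, h3⟩
    · have := hstep b hab (by omega)
      exact ⟨b + 1, by omega, le_rfl, by omega⟩

theorem le_add_of_steps {h : ℕ → ℕ} {N : ℕ}
    (hup : ∀ i, i + 1 < N → h i ≤ h (i + 1) + 1) (hdown : ∀ i, i + 1 < N → h (i + 1) ≤ h i + 1)
    {i j : ℕ} (hi : i < N) (hj : j < N) : h i ≤ h j + ((i - j) + (j - i)) := by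
  have key : ∀ d i, i + d < N → h i ≤ h (i + d) + d ∧ h (i + d) ≤ h i + d := by
    intro d
    induction d with
    | zero => intro i _; simp
    | succ d ih =>
      intro i hid
      have h1 := ih i (by omega)
      have h2 := hup (i + d) (by omega)
      have h3 := hdown (i + d) (by omega)
      rw [show i + (d + 1) = i + d + 1 by ring]
      omega
  rcases le_total i j with hij | hij
  · have := (key (j - i) i (by omega)).1
    rw [Nat.add_sub_cancel' hij] at this
    omega
  · have := (key (i - j) j (by omega)).2
    rw [Nat.add_sub_cancel' hij] at this
    omega

/-- A sequence that starts far from a set, at two places, and reaches it late, at two places,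
passes some level exactly once. -/
theorem exists_unique_crossing {k a₁ a₂ b₁ b₂ : ℕ} {h : ℕ → ℕ}
    (hup : ∀ i, i + 1 < 4 * k - 1 → h i ≤ h (i + 1) + 1)
    (hdown : ∀ i, i + 1 < 4 * k - 1 → h (i + 1) ≤ h i + 1)
    (h12 : a₁ < a₂) (h23 : a₂ < b₁) (h34 : b₁ < b₂) (h4 : b₂ < 4 * k - 1)
    (ha₁ : 2 * k - 1 ≤ h a₁) (ha₂ : 2 * k - 1 ≤ h a₂) (hb₁ : h b₁ = 0) (hb₂ : h b₂ = 0) :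
    ∃ y, a₂ < y ∧ y < b₁ ∧ h y < 2 * k - 1 ∧ (∀ i, i < y → h y < h i) ∧
      ∀ j, y < j → j < 4 * k - 1 → h j < h y := by
  have lip := fun {i j : ℕ} => le_add_of_steps (i := i) (j := j) hup hdown
  have hsep := lip (i := a₂) (j := b₁) (by omega) (by omega)
  -- Each i ≤ a₂ is within a₂ - 1 of a₁ or of a₂; the second point gains the one that is needed.
  -- `hsuf` is the mirror image.
  have hpre : ∀ i, i ≤ a₂ → 2 * k - a₂ ≤ h i := by
    intro i hi
    have e1 := lip (i := a₁) (j := i) (by omega) (by omega)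
    have e2 := lip (i := a₂) (j := i) (by omega) (by omega)
    omega
  have hsuf : ∀ j, b₁ ≤ j → j < 4 * k - 1 → h j ≤ 4 * k - 3 - b₁ := by
    intro j hj hj'
    have e1 := lip (i := j) (j := b₁) (by omega) (by omega)
    have e2 := lip (i := j) (j := b₂) (by omega) (by omega)
    omega
  have hcross : ∀ D, ∀ a b, a ≤ b → b < 4 * k - 1 → D ≤ h a → h b ≤ D →
      ∃ i, a ≤ i ∧ i ≤ b ∧ h i = D := fun D a b hab hb h1 h2 =>
    exists_eq_of_steps hab (fun i _ hi => hup i (by omega)) h1 h2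
  let M := Finset.Ioo a₂ b₁
  let fib : ℕ → Finset ℕ := fun D => M.filter fun i => h i = D
  have hne : ∀ D, 1 ≤ D → D ≤ 2 * k - 2 → 1 ≤ (fib D).card := by
    intro D h1 h2
    obtain ⟨i, e1, e2, e3⟩ := hcross D a₂ b₁ (by omega) (by omega) (by omega) (by omega)
    refine Finset.card_pos.2 ⟨i, Finset.mem_filter.2 ⟨Finset.mem_Ioo.2 ⟨?_, ?_⟩, e3⟩⟩
    · rcases e1.lt_or_eq with h | rfl
      · exact h
      · omega
    · rcases e2.lt_or_eq with h | rfl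
      · exact h
      · omega
  -- The levels of this window occur neither up to a₂ nor from b₁ on. If each occurred twice in
  -- between, and the other levels from 1 to 2k - 2 at least once, there would be (2k - 2) + (b₁ -
  -- a₂ - 2k + 2) = b₁ - a₂ positions strictly between a₂ and b₁, one too many.
  have huniq : ∃ D, 4 * k - 2 - b₁ ≤ D ∧ D ≤ 2 * k - 1 - a₂ ∧ (fib D).card ≤ 1 := by
    by_contra! hcon
    have hsum : ∑ D ∈ Finset.Icc 1 (2 * k - 2), (fib D).card ≤ M.card := by
      rw [← Finset.card_biUnion]
      · exact Finset.card_le_card fun i hi => by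
          obtain ⟨D, _, hD⟩ := Finset.mem_biUnion.1 hi
          exact (Finset.mem_filter.1 hD).1
      · intro D _ D' _ hDD
        exact Finset.disjoint_left.2 fun i hi hi' => hDD
          ((Finset.mem_filter.1 hi).2.symm.trans (Finset.mem_filter.1 hi').2)
    have hlow : ∑ D ∈ Finset.Icc 1 (2 * k - 2),
        (1 + if D ∈ Finset.Icc (4 * k - 2 - b₁) (2 * k - 1 - a₂) then 1 else 0) ≤
        ∑ D ∈ Finset.Icc 1 (2 * k - 2), (fib D).card := by
      refine Finset.sum_le_sum fun D hD => ?_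
      rw [Finset.mem_Icc] at hD
      split_ifs with hD'
      · rw [Finset.mem_Icc] at hD'
        exact hcon D hD'.1 hD'.2
      · exact hne D hD.1 hD.2
    rw [Finset.sum_add_distrib, Finset.sum_ite_mem, Finset.inter_eq_right.2
      (Finset.Icc_subset_Icc (by omega) (by omega))] at hlow
    simp only [Finset.sum_const, Nat.card_Icc, smul_eq_mul, mul_one] at hlow
    simp only [M, Nat.card_Ioo] at hsum
    omega
  obtain ⟨D, hD1, hD2, hD⟩ := huniq
  obtain ⟨y, hy⟩ := Finset.card_pos.1 (hne D (by omega) (by omega))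
  have hy' := Finset.mem_filter.1 hy
  rw [Finset.mem_Ioo] at hy'
  obtain ⟨⟨hy1, hy2⟩, hyD⟩ := hy'
  have honly : ∀ i, a₂ < i → i < b₁ → h i = D → i = y := fun i h1 h2 h3 =>
    Finset.card_le_one.1 hD i (Finset.mem_filter.2 ⟨Finset.mem_Ioo.2 ⟨h1, h2⟩, h3⟩) y hy
  refine ⟨y, hy1, hy2, by omega, fun i hi => ?_, fun j hj hj' => ?_⟩
  · rcases le_or_gt i a₂ with hia | hia
    · have := hpre i hia
      omega
    · by_contra hcon
      obtain ⟨i', e1, e2, e3⟩ := hcross D a₂ i (by omega) (by omega) (by omega) (by omega)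
      have : a₂ ≠ i' := by rintro rfl; omega
      have := honly i' (by omega) (by omega) e3
      omega
  · rcases le_or_gt b₁ j with hjb | hjb
    · have := hsuf j hjb hj'
      omega
    · by_contra hcon
      obtain ⟨i', e1, e2, e3⟩ := hcross D j b₁ (by omega) (by omega) (by omega) (by omega)
      have : i' ≠ b₁ := by rintro rfl; omega
      have := honly i' (by omega) (by omega) e3
      omega

/-! ### The verifier -/

/-- The first `t` terms of `x` form an induced path for the relation `K`. -/
def IsInducedPath {α : Type*} (K : α → α → Prop) (t : ℕ) (x : ℕ → α) : Prop :=
  ∀ i j, i < j → j < t → x i ≠ x j ∧ (K (x i) (x j) ↔ j = i + 1)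

theorem IsInducedPath.mono {α : Type*} {K : α → α → Prop} {s t : ℕ} {x : ℕ → α}
    (h : IsInducedPath K t x) (hst : s ≤ t) : IsInducedPath K s x :=
  fun i j hij hj => h i j hij (hj.trans_le hst)

namespace FactSet

/-- The label of the cluster of a high vertex, `1` for a low vertex, `0` if there is no such
vertex. -/
def label (C : FactSet) (a : ℕ) : ℕ := C.val 0 a 0

/-- The depth in the spanning tree of the cluster. -/
def depth (C : FactSet) (a : ℕ) : ℕ := C.val 1 a 0

/-- The vertex that compares what `a` and its parent have read. -/
def mid (C : FactSet) (a : ℕ) : ℕ := C.val 2 a 0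

/-- The parent in the spanning tree of the cluster. -/
def parent (C : FactSet) (a : ℕ) : ℕ := C.val 3 a 0

/-- The distance of `a` to the cluster `B`; infinite distances are recorded as `0`, finite ones
are shifted by one. -/
def far (k : ℕ) (C : FactSet) (B a : ℕ) : ℕ :=
  -- The default 2k - 1 is the separation of clusters, so `far_other` also holds for unreachable or
  -- nonexistent clusters.
  if C.val 4 B a = 0 then 2 * k - 1 else C.val 4 B a - 1

/-- The number of vertices of a longest induced path that starts at `a` and then stays strictly
closer to the cluster `B`. -/
def reach (C : FactSet) (B a : ℕ) : ℕ := C.val 5 B a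

/-- The neighbours `b` of a low vertex `a`. -/
def LowAdj (C : FactSet) (a b : ℕ) : Prop := (6, a, b, 1) ∈ C

/-- The certificate contains the list of neighbours of the high vertex `z`. -/
def Holds (F : FactSet) (z : ℕ) : Prop := (7, z, 0, 0) ∈ F

def Lists (F : FactSet) (z b : ℕ) : Prop := (8, z, b, 0) ∈ F

end FactSet

open FactSet

/-- The adjacency between `a` and `b` as far as the vertex `c` can know it: all edges except those
inside clusters other than its own. -/
def KnownAdj (c : ℕ) (E : ℕ → ℕ → Prop) (L : ℕ → FactSet → Prop) (C : FactSet) (a b : ℕ) : Prop :=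
  (C.label a = 1 ∧ C.LowAdj a b) ∨ (C.label a ≠ 1 ∧ C.label b = 1 ∧ C.LowAdj b a) ∨
    (C.label a ≠ 1 ∧ C.label a = C.label b ∧ ∃ w F, E c w ∧ L w F ∧ F.Holds a ∧ F.Lists a b)

/-- The conditions checked by the vertex `c` that sees the edges `E` and the certificates `L`,
when the common part of its own certificate is `C`. -/
structure Accepts (k c : ℕ) (E : ℕ → ℕ → Prop) (L : ℕ → FactSet → Prop) (C : FactSet) :
    Prop where
  common : ∀ w F, E c w → L w F → F.common = C
  vertex : C.label c ≠ 0
  low : C.label c = 1 → ∀ w, C.LowAdj c w ↔ E c w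
  lipschitz : ∀ w, E c w → ∀ B, C.far k B c ≤ C.far k B w + 1
  far_self : C.label c ≠ 1 → C.far k (C.label c) c = 0
  far_other : C.label c ≠ 1 → ∀ B, B ≠ C.label c → 2 * k - 1 ≤ C.far k B c
  holder : C.label c ≠ 1 → ∀ z, C.label z = C.label c → ∃ w F, E c w ∧ L w F ∧ F.Holds z
  agree : C.label c ≠ 1 → ∀ z, C.label z = C.label c → ∀ w F w' F', E c w → L w F → E c w' →
    L w' F' → F.Holds z → F'.Holds z → ∀ b, F.Lists z b → F'.Lists z b
  own : C.label c ≠ 1 → ∀ w F, E c w → L w F → F.Holds c → ∀ b, F.Lists c b ↔ E c b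
  -- A cluster is named by the identifier of its root plus one, so the label determines the root.
  link : C.label c ≠ 1 → c + 1 = C.label c ∨ ((∃ F, L (C.mid c) F) ∧
    C.label (C.parent c) = C.label c ∧ C.depth (C.parent c) < C.depth c)
  -- This check is made by the vertex named as the middle of u, which sees the neighbours of both u
  -- and its parent.
  middle : ∀ u, C.mid u = c → ∀ z, C.label z = C.label u → ∃ w F w' F',
    E u w ∧ L w F ∧ E (C.parent u) w' ∧ L w' F' ∧ F.Holds z ∧ F'.Holds z ∧
      ∀ b, F.Lists z b ↔ F'.Lists z b
  -- If the sequence never repeats a foreign cluster, its known adjacencies are the true ones, so it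
  -- must not be an induced path.
  free : ∀ x : ℕ → ℕ, (∀ i < 4 * k - 1, C.label (x i) ≠ 0) →
    IsInducedPath (KnownAdj c E L C) (4 * k - 1) x →
    ∃ i j, i < j ∧ j < 4 * k - 1 ∧ C.label (x i) = C.label (x j) ∧ C.label (x i) ≠ 1 ∧
      C.label (x i) ≠ C.label c
  near : C.label c ≠ 1 → ∀ (x : ℕ → ℕ) (t : ℕ),
    (∀ i ≤ t, C.label (x i) = 1 ∨ C.label (x i) = C.label c) →
    IsInducedPath (KnownAdj c E L C) (t + 1) x →
    (∀ i, 0 < i → i ≤ t → C.far k (C.label c) (x i) < C.far k (C.label c) (x 0)) →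
    t + 1 ≤ C.reach (C.label c) (x 0)
  combine : C.label c ≠ 1 → ∀ B, B ≠ C.label c → ∀ (x : ℕ → ℕ) (t : ℕ),
    (∀ i ≤ t, C.label (x i) = 1 ∨ C.label (x i) = C.label c) →
    IsInducedPath (KnownAdj c E L C) (t + 1) x →
    (∀ i < t, C.far k B (x t) < C.far k B (x i)) →
    C.reach B (x t) ≠ 0 → t + C.reach B (x t) < 4 * k - 1

/-! ### Soundness -/

/-- What the visible edges `E v` and certificates `L v` of a vertex `v` have to do with the
network. -/
structure Sees {V : Type*} (G : SimpleGraph V) (ident : V → ℕ) (F : V → FactSet)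
    (E : V → ℕ → ℕ → Prop) (L : V → ℕ → FactSet → Prop) : Prop where
  inj : Function.Injective ident
  edge : ∀ v b, E v (ident v) b ↔ ∃ w, G.Adj v w ∧ b = ident w
  of_edge : ∀ v a b, E v a b → ∃ x y, G.Adj x y ∧ G.Reachable v x ∧ a = ident x ∧ b = ident y
  of_label : ∀ v a F', L v a F' → ∃ w, G.Reachable v w ∧ a = ident w ∧ F' = F w
  label_adj : ∀ v w, G.Adj v w → L v (ident w) (F w)

section Soundness

variable {V : Type*} {G : SimpleGraph V} {ident : V → ℕ} {F : V → FactSet}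
  {E : V → ℕ → ℕ → Prop} {L : V → ℕ → FactSet → Prop} {k : ℕ}

theorem Sees.eq_of_label (hS : Sees G ident F E L) {v w : V} {F' : FactSet}
    (h : L v (ident w) F') : F' = F w := by
  obtain ⟨w', -, h1, h2⟩ := hS.of_label _ _ _ h
  rw [h2, hS.inj h1]

theorem Sees.common_eq (hS : Sees G ident F E L)
    (hA : ∀ v, Accepts k (ident v) (E v) (L v) (F v).common) {u v : V} (h : G.Reachable u v) :
    (F v).common = (F u).common := by
  obtain ⟨p⟩ := h
  induction p with
  | nil => rfl
  | cons hadj p ih =>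
    rw [ih]
    exact (hA _).common _ _ ((hS.edge _ _).2 ⟨_, hadj, rfl⟩) (hS.label_adj _ _ hadj)

/-- The vertex `b` is in the list of neighbours of `z` that `u` can read at its neighbours. -/
def Reads (G : SimpleGraph V) (F : V → FactSet) (u : V) (z b : ℕ) : Prop :=
  ∃ w, G.Adj u w ∧ (F w).Holds z ∧ (F w).Lists z b

variable {R : Set V} {C : FactSet}

theorem Sees.lists_iff (hS : Sees G ident F E L) {u w : V}
    (hA : Accepts k (ident u) (E u) (L u) C) (hu : C.label (ident u) ≠ 1)
    {z : ℕ} (hz : C.label z = C.label (ident u)) (hw : G.Adj u w) (hh : (F w).Holds z) (b : ℕ) :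
    (F w).Lists z b ↔ Reads G F u z b :=
  ⟨fun h => ⟨w, hw, hh, h⟩, fun ⟨_, hw', hh', h⟩ => hA.agree hu z hz _ _ _ _
    ((hS.edge _ _).2 ⟨_, hw', rfl⟩) (hS.label_adj _ _ hw') ((hS.edge _ _).2 ⟨_, hw, rfl⟩)
    (hS.label_adj _ _ hw) hh' hh b h⟩

/-- Induction on depth. `link` makes the middle vertex visible, hence a member of the same component
that accepts; its check `middle` shows that u and its parent read the same lists. -/
theorem Sees.exists_root (hS : Sees G ident F E L)
    (hR : ∀ u v, u ∈ R → G.Reachable u v → v ∈ R)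
    (hA : ∀ v ∈ R, Accepts k (ident v) (E v) (L v) C) :
    ∀ d, ∀ u ∈ R, C.depth (ident u) = d → C.label (ident u) ≠ 1 → ∃ r ∈ R,
      ident r + 1 = C.label (ident u) ∧ C.label (ident r) = C.label (ident u) ∧
      ∀ z, C.label z = C.label (ident u) → ∀ b, Reads G F u z b ↔ Reads G F r z b := by
  intro d
  induction d using Nat.strong_induction_on with
  | _ d ih =>
  intro u hu hd hu1
  rcases (hA u hu).link hu1 with hroot | ⟨⟨F', hF'⟩, hlab, hdep⟩
  · exact ⟨u, hu, hroot, rfl, fun _ _ _ => Iff.rfl⟩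
  obtain ⟨x, hux, hx, -⟩ := hS.of_label _ _ _ hF'
  have hxR := hR _ _ hu hux
  have hmid := (hA x hxR).middle (ident u) hx
  obtain ⟨p, hxp, hp⟩ : ∃ p, G.Reachable x p ∧ C.parent (ident u) = ident p := by
    obtain ⟨_, _, _, _, _, _, hE', _⟩ := hmid (ident u) rfl
    obtain ⟨p, _, _, hxp, hp, _⟩ := hS.of_edge _ _ _ hE'
    exact ⟨p, hxp, hp⟩
  have hpR := hR _ _ hxR hxp
  rw [hp] at hlab hdep hmid
  obtain ⟨r, hrR, hr1, hr2, hr3⟩ := ih _ (hd ▸ hdep) p hpR rfl (hlab ▸ hu1)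
  rw [hlab] at hr1 hr2 hr3
  refine ⟨r, hrR, hr1, hr2, fun z hz b => Iff.trans ?_ (hr3 z hz b)⟩
  obtain ⟨_, F₁, _, F₂, hE₁, hL₁, hE₂, hL₂, hh₁, hh₂, hb⟩ := hmid z hz
  obtain ⟨x₁, y₁, hadj₁, -, hx₁, rfl⟩ := hS.of_edge _ _ _ hE₁
  obtain ⟨x₂, y₂, hadj₂, -, hx₂, rfl⟩ := hS.of_edge _ _ _ hE₂
  obtain rfl := hS.inj hx₁
  obtain rfl := hS.inj hx₂
  obtain rfl := hS.eq_of_label hL₁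
  obtain rfl := hS.eq_of_label hL₂
  rw [← hS.lists_iff (hA _ hu) hu1 hz hadj₁ hh₁, ← hS.lists_iff (hA _ hpR) (hlab ▸ hu1)
    (hz.trans hlab.symm) hadj₂ hh₂]
  exact hb b

/-- Equal labels give the same root, so u reads for v what v reads for itself, and v has compared
that with its actual edges. -/
theorem Sees.reads_iff_adj (hS : Sees G ident F E L)
    (hR : ∀ u v, u ∈ R → G.Reachable u v → v ∈ R)
    (hA : ∀ v ∈ R, Accepts k (ident v) (E v) (L v) C) {u v : V} (hu : u ∈ R) (hv : v ∈ R)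
    (huv : C.label (ident u) = C.label (ident v)) (h1 : C.label (ident v) ≠ 1) (b : ℕ) :
    Reads G F u (ident v) b ↔ ∃ w, G.Adj v w ∧ b = ident w := by
  obtain ⟨r, -, hr, -, hr'⟩ := hS.exists_root hR hA _ u hu rfl (huv ▸ h1)
  obtain ⟨s, -, hs, -, hs'⟩ := hS.exists_root hR hA _ v hv rfl h1
  obtain rfl : r = s := hS.inj (by omega)
  rw [hr' _ huv.symm, ← hs' _ rfl, ← hS.edge]
  obtain ⟨w, F', hE, hL, hh⟩ := (hA v hv).holder h1 _ rfl
  obtain ⟨w, hw, rfl⟩ := (hS.edge _ _).1 hE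
  obtain rfl := hS.eq_of_label hL
  rw [← hS.lists_iff (hA v hv) h1 rfl hw hh]
  exact (hA v hv).own h1 _ _ hE hL hh b

/-- Low vertices vouch for their own lists, and `Sees.reads_iff_adj` covers the cluster of c. An
edge between two clusters would force 2k - 1 ≤ 1 by the distance checks, impossible for k ≥ 2. -/
theorem Sees.knownAdj_iff (hS : Sees G ident F E L)
    (hR : ∀ u v, u ∈ R → G.Reachable u v → v ∈ R) (hk : 2 ≤ k)
    (hA : ∀ v ∈ R, Accepts k (ident v) (E v) (L v) C) {c u v : V} (hc : c ∈ R) (hu : u ∈ R)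
    (hv : v ∈ R) (huv : C.label (ident u) = C.label (ident v) → C.label (ident u) = 1 ∨
      C.label (ident u) = C.label (ident c)) :
    KnownAdj (ident c) (E c) (L c) C (ident u) (ident v) ↔ G.Adj u v := by
  have hedge : ∀ x y, E x (ident x) (ident y) ↔ G.Adj x y := fun x y => by
    rw [hS.edge]
    exact ⟨fun ⟨w, hw, hyw⟩ => hS.inj hyw ▸ hw, fun h => ⟨y, h, rfl⟩⟩
  unfold KnownAdj
  by_cases hu1 : C.label (ident u) = 1
  · simp [hu1, (hA u hu).low hu1, hedge]
  by_cases hv1 : C.label (ident v) = 1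
  · simp [hu1, hv1, (hA v hv).low hv1, hedge, G.adj_comm]
  simp only [hu1, hv1, false_and, ne_eq, not_false_eq_true, true_and, false_or]
  by_cases huv' : C.label (ident u) = C.label (ident v)
  · have hcu := (huv huv').resolve_left hu1
    have h := hS.reads_iff_adj hR hA hc hu hcu.symm hu1 (ident v)
    rw [← hS.edge, hedge] at h
    rw [← h]
    refine ⟨fun ⟨_, w, F', hE, hL, h1, h2⟩ => ?_, fun ⟨w, hw, h1, h2⟩ =>
      ⟨huv', _, _, (hS.edge _ _).2 ⟨w, hw, rfl⟩, hS.label_adj _ _ hw, h1, h2⟩⟩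
    obtain ⟨w, hw, rfl⟩ := (hS.edge _ _).1 hE
    obtain rfl := hS.eq_of_label hL
    exact ⟨w, hw, h1, h2⟩
  · simp only [huv', false_and, false_iff]
    intro hadj
    have h1 := (hA u hu).lipschitz _ ((hedge _ _).2 hadj) (C.label (ident v))
    have h2 := (hA u hu).far_other hu1 _ (Ne.symm huv')
    have h3 := (hA v hv).far_self hv1
    omega

/-- If all vertices accept, there is no induced path on `4 * k - 1` vertices. -/
theorem Sees.not_isInducedPath (hS : Sees G ident F E L) (hk : 2 ≤ k)
    (hA : ∀ v, Accepts k (ident v) (E v) (L v) (F v).common) (y : ℕ → V)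
    (hy : IsInducedPath G.Adj (4 * k - 1) y) : False := by
  -- The graph may be disconnected and certificates agree only within a component, so everything is
  -- confined to the component of the path.
  obtain ⟨R, hRdef⟩ : ∃ R : Set V, R = {v | G.Reachable (y 0) v} := ⟨_, rfl⟩
  obtain ⟨C, hC⟩ : ∃ C, C = (F (y 0)).common := ⟨_, rfl⟩
  have hR : ∀ u v, u ∈ R → G.Reachable u v → v ∈ R := by
    subst hRdef
    exact fun u v hu huv => SimpleGraph.Reachable.trans hu huv
  replace hA : ∀ v ∈ R, Accepts k (ident v) (E v) (L v) C := by
    subst hRdef hC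
    exact fun v hv => hS.common_eq hA hv ▸ hA v
  have hadj : ∀ i, i + 1 < 4 * k - 1 → G.Adj (y i) (y (i + 1)) := fun i hi =>
    (hy i (i + 1) (by omega) hi).2.2 rfl
  have hyR : ∀ i, i < 4 * k - 1 → y i ∈ R := by
    intro i
    induction i with
    | zero => intro _; rw [hRdef]; exact SimpleGraph.Reachable.refl _
    | succ i ih => exact fun hi => hR _ _ (ih (by omega)) (hadj i hi).reachable
  let e : ℕ → ℕ := fun i => C.label (ident (y i))
  have hup : ∀ B i, i + 1 < 4 * k - 1 →
      C.far k B (ident (y i)) ≤ C.far k B (ident (y (i + 1))) + 1 := fun B i hi =>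
    (hA _ (hyR i (by omega))).lipschitz _ ((hS.edge _ _).2 ⟨_, hadj i hi, rfl⟩) B
  have hdown : ∀ B i, i + 1 < 4 * k - 1 →
      C.far k B (ident (y (i + 1))) ≤ C.far k B (ident (y i)) + 1 := fun B i hi =>
    (hA _ (hyR _ hi)).lipschitz _ ((hS.edge _ _).2 ⟨_, (hadj i hi).symm, rfl⟩) B
  have hzero : ∀ i, i < 4 * k - 1 → e i ≠ 1 → C.far k (e i) (ident (y i)) = 0 := fun i hi h1 =>
    (hA _ (hyR i hi)).far_self h1
  have hfar : ∀ i, i < 4 * k - 1 → e i ≠ 1 → ∀ B, B ≠ e i → 2 * k - 1 ≤ C.far k B (ident (y i)) :=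
    fun i hi h1 => (hA _ (hyR i hi)).far_other h1
  have hsep : ∀ i j, i < 4 * k - 1 → j < 4 * k - 1 → e i ≠ 1 → e j ≠ 1 → e i ≠ e j →
      2 * k - 1 ≤ (i - j) + (j - i) := by
    intro i j hi hj hi1 hj1 hij
    have h1 := le_add_of_steps (h := fun i => C.far k (e j) (ident (y i))) (hup _) (hdown _) hi hj
    have h2 := hfar i hi hi1 (e j) hij.symm
    have h3 := hzero j hj hj1
    omega
  -- No path passes twice through one cluster and then twice through another one
  have key : ∀ a₁ a₂ b₁ b₂, a₁ < a₂ → a₂ < b₁ → b₁ < b₂ → b₂ < 4 * k - 1 → e a₁ = e a₂ →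
      e b₁ = e b₂ → e a₁ ≠ 1 → e b₁ ≠ 1 → e a₁ ≠ e b₁ → False := by
    intro a₁ a₂ b₁ b₂ h12 h23 h34 h4 ha hb ha1 hb1 hab
    obtain ⟨s, hs1, hs2, hs3, hpre, hsuf⟩ := exists_unique_crossing
      (h := fun i => C.far k (e b₁) (ident (y i))) (hup _) (hdown _) h12 h23 h34 h4
      (hfar a₁ (by omega) ha1 _ hab.symm) (hfar a₂ (by omega) (ha ▸ ha1) _ (ha ▸ hab.symm))
      (hzero b₁ (by omega) hb1) (hb ▸ hzero b₂ (by omega) (hb ▸ hb1))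
    -- Three clusters pairwise 2k - 1 apart would span 4k - 2 steps, the whole path, leaving no room
    -- for a₁ before a₂ or b₂ after b₁.
    have hcases : ∀ i, i < 4 * k - 1 → e i = 1 ∨ e i = e a₁ ∨ e i = e b₁ := by
      intro i hi
      by_contra! hcon
      have e1 := hsep i a₂ hi (by omega) hcon.1 (ha ▸ ha1) (ha ▸ hcon.2.1)
      have e2 := hsep i b₁ hi (by omega) hcon.1 hb1 hcon.2.2
      have e3 := hsep a₂ b₁ (by omega) (by omega) (ha ▸ ha1) hb1 (ha ▸ hab)
      omega
    have hknown : ∀ c ∈ R, ∀ i j, i < j → j < 4 * k - 1 →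
        (e i = 1 ∨ e i = C.label (ident c)) → (ident (y i) ≠ ident (y j) ∧
        (KnownAdj (ident c) (E c) (L c) C (ident (y i)) (ident (y j)) ↔ j = i + 1)) := by
      intro c hc i j hij hj hi
      have h := hy i j hij hj
      refine ⟨fun h' => h.1 (hS.inj h'), Iff.trans ?_ h.2⟩
      exact hS.knownAdj_iff hR hk hA hc (hyR i (by omega)) (hyR j hj) fun _ => hi
    have hsmall : 0 < C.far k (e b₁) (ident (y s)) := by
      have := hsuf b₁ hs2 (by omega)
      omega
    have hAside : ∀ i ≤ s, e i = 1 ∨ e i = e a₁ := by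
      intro i hi
      rcases hcases i (by omega) with h | h | h
      · exact Or.inl h
      · exact Or.inr h
      · have h0 : C.far k (e b₁) (ident (y i)) = 0 := h ▸ hzero i (by omega) (h ▸ hb1)
        rcases hi.lt_or_eq with hi | rfl
        · have := hpre i hi
          omega
        · omega
    have hBside : ∀ i, s ≤ i → i < 4 * k - 1 → e i = 1 ∨ e i = e b₁ := by
      intro i hi hi'
      rcases hcases i hi' with h | h | h
      · exact Or.inl h
      · have h0 := hfar i hi' (h ▸ ha1) (e b₁) (h ▸ hab.symm)
        rcases hi.lt_or_eq with hi | rfl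
        · have := hsuf i hi hi'
          omega
        · omega
      · exact Or.inr h
    -- A vertex of B certifies the part from s on; next a vertex of A adds the s vertices before.
    -- The parts total 4k - 1 vertices, which `combine` forbids.
    have hnear := (hA _ (hyR b₁ (by omega))).near hb1 (fun i => ident (y (s + i)))
      (4 * k - 2 - s) (fun i hi => hBside (s + i) (by omega) (by omega))
      (fun i j hij hj => by
        obtain ⟨h1, h2⟩ := hknown _ (hyR b₁ (by omega)) (s + i) (s + j) (by omega) (by omega)
          (hBside _ (by omega) (by omega))
        exact ⟨h1, h2.trans (by omega)⟩)
      (fun i hi hi' => hsuf (s + i) (by omega) (by omega))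
    replace hnear : 4 * k - 2 - s + 1 ≤ C.reach (e b₁) (ident (y s)) := hnear
    have hcomb := (hA _ (hyR a₁ (by omega))).combine ha1 (e b₁) hab.symm (fun i => ident (y i)) s
      hAside
      (fun i j hij hj => hknown _ (hyR a₁ (by omega)) i j hij (by omega) (hAside i (by omega)))
      hpre (by omega)
    replace hcomb : s + C.reach (e b₁) (ident (y s)) < 4 * k - 1 := hcomb
    omega
  -- Otherwise the vertex at position l knows all adjacencies along the path, and its check `free`
  -- fails.
  have htwice : ∀ l, l < 4 * k - 1 → ∃ i j, i < j ∧ j < 4 * k - 1 ∧ e i = e j ∧ e i ≠ 1 ∧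
      e i ≠ e l := by
    intro l hl
    by_contra hcon
    refine hcon ((hA _ (hyR l hl)).free (fun i => ident (y i))
      (fun i hi => (hA _ (hyR i hi)).vertex) ?_)
    intro i j hij hj
    have h := hy i j hij hj
    refine ⟨fun h' => h.1 (hS.inj h'), Iff.trans ?_ h.2⟩
    refine hS.knownAdj_iff hR hk hA (hyR l hl) (hyR i (by omega)) (hyR j hj) fun hlab => ?_
    by_contra! hne
    exact hcon ⟨i, j, hij, hj, hlab, hne.1, hne.2⟩
  -- Position 0 supplies a cluster met twice; applying the claim at a vertex of that cluster
  -- supplies a different one. Interleaved visits would need more than 4k - 1 positions.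
  obtain ⟨b₁, b₂, hb12, hb2, hb, hb1, -⟩ := htwice 0 (by omega)
  obtain ⟨a₁, a₂, ha12, ha2, ha, ha1, hab⟩ := htwice b₁ (by omega)
  have s11 := hsep a₁ b₁ (by omega) (by omega) ha1 hb1 hab
  have s12 := hsep a₁ b₂ (by omega) (by omega) ha1 (hb ▸ hb1) (hb ▸ hab)
  have s21 := hsep a₂ b₁ (by omega) (by omega) (ha ▸ ha1) hb1 (ha ▸ hab)
  have s22 := hsep a₂ b₂ (by omega) (by omega) (ha ▸ ha1) (hb ▸ hb1) (ha ▸ hb ▸ hab)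
  rcases (by omega : a₂ < b₁ ∨ b₂ < a₁) with h | h
  · exact key a₁ a₂ b₁ b₂ ha12 h hb12 hb2 ha hb ha1 hb1 hab
  · exact key b₁ b₂ a₁ a₂ hb12 h ha12 ha2 hb ha hb1 ha1 hab.symm

end Soundness

/-! ### Clusters of vertices of high degree -/

section Clusters

variable {V : Type*} (G : SimpleGraph V) (ident : V → ℕ) (q κ : ℕ)

def IsHigh (u : V) : Prop := q ≤ (G.neighborSet u).ncard

/-- Two high vertices are linked when some vertex sees all neighbours of both. -/
def linkGraph : SimpleGraph V where
  Adj u v := u ≠ v ∧ IsHigh G q u ∧ IsHigh G q v ∧ ∃ x, G.edist x u ≤ κ ∧ G.edist x v ≤ κ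
  symm := ⟨fun _ _ ⟨h, hu, hv, x, hxu, hxv⟩ => ⟨h.symm, hv, hu, x, hxv, hxu⟩⟩
  loopless := ⟨fun _ h => h.1 rfl⟩

noncomputable def clusterRoot (u : V) : V := ((linkGraph G q κ).connectedComponentMk u).out

open Classical in
noncomputable def clusterLabel (u : V) : ℕ :=
  if IsHigh G q u then ident (clusterRoot G q κ u) + 1 else 1

noncomputable def clusterDepth (u : V) : ℕ := (linkGraph G q κ).dist u (clusterRoot G q κ u)

def IsNonRoot (u : V) : Prop := IsHigh G q u ∧ u ≠ clusterRoot G q κ u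

open Classical in
noncomputable def clusterParent (u : V) : V :=
  if h : ∃ p, (linkGraph G q κ).Adj u p ∧
    (linkGraph G q κ).dist p (clusterRoot G q κ u) < clusterDepth G q κ u then h.choose else u

open Classical in
noncomputable def clusterMid (u : V) : V :=
  if h : ∃ x, G.edist x u ≤ κ ∧ G.edist x (clusterParent G q κ u) ≤ κ then h.choose else u

noncomputable def clusterDist (B : ℕ) (v : V) : ℕ∞ :=
  ⨅ u : {u // IsHigh G q u ∧ clusterLabel G ident q κ u = B}, G.edist v u

open Classical in
noncomputable def clusterFar (B : ℕ) (v : V) : ℕ :=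
  if clusterDist G ident q κ B v = ⊤ then 2 * (κ + 1) - 1
  else (clusterDist G ident q κ B v).toNat

open Classical in
noncomputable def clusterReach [Fintype V] (B : ℕ) (v : V) : ℕ :=
  Nat.findGreatest (fun t => ∃ x : ℕ → V, x 0 = v ∧ IsInducedPath G.Adj t x ∧
    ∀ i, 0 < i → i < t → clusterFar G ident q κ B (x i) < clusterFar G ident q κ B v)
    (Fintype.card V)

variable {G ident q κ}

theorem reachable_clusterRoot (u : V) : (linkGraph G q κ).Reachable u (clusterRoot G q κ u) :=
  (SimpleGraph.ConnectedComponent.exact (Quot.out_eq _)).symm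

theorem clusterRoot_eq_iff {u v : V} :
    clusterRoot G q κ u = clusterRoot G q κ v ↔ (linkGraph G q κ).Reachable u v := by
  refine ⟨fun h => (reachable_clusterRoot u).trans (h ▸ (reachable_clusterRoot v).symm), fun h => ?_⟩
  rw [clusterRoot, clusterRoot, SimpleGraph.ConnectedComponent.sound h]

theorem IsHigh.of_reachable {u v : V} (hu : IsHigh G q u) (h : (linkGraph G q κ).Reachable u v) :
    IsHigh G q v := by
  obtain ⟨p⟩ := h
  induction p with
  | nil => exact hu
  | cons hadj _ ih => exact ih hadj.2.2.1

theorem IsHigh.clusterLabel_eq {u : V} (hu : IsHigh G q u) :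
    clusterLabel G ident q κ u = ident (clusterRoot G q κ u) + 1 := if_pos hu

theorem clusterLabel_ne_zero (u : V) : clusterLabel G ident q κ u ≠ 0 := by
  unfold clusterLabel
  split_ifs <;> omega

theorem clusterLabel_eq_one_iff (hid : ∀ v, 1 ≤ ident v) {u : V} :
    clusterLabel G ident q κ u = 1 ↔ ¬ IsHigh G q u := by
  unfold clusterLabel
  have := hid (clusterRoot G q κ u)
  split_ifs with h <;> simp [h]
  omega

theorem clusterLabel_eq_of_reachable {u v : V} (hu : IsHigh G q u)
    (h : (linkGraph G q κ).Reachable u v) :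
    clusterLabel G ident q κ u = clusterLabel G ident q κ v := by
  rw [hu.clusterLabel_eq, (hu.of_reachable h).clusterLabel_eq, clusterRoot_eq_iff.2 h]

theorem clusterLabel_eq_of_near {u v x : V} (hu : IsHigh G q u) (hv : IsHigh G q v)
    (hxu : G.edist x u ≤ κ) (hxv : G.edist x v ≤ κ) :
    clusterLabel G ident q κ u = clusterLabel G ident q κ v := by
  by_cases huv : u = v
  · rw [huv]
  · exact clusterLabel_eq_of_reachable hu
      (SimpleGraph.Adj.reachable (show (linkGraph G q κ).Adj u v from ⟨huv, hu, hv, x, hxu, hxv⟩))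

/-- The vertex κ steps along a walk of length at most 2κ is within κ of both ends, and would link
them. -/
theorem lt_edist_of_clusterLabel_ne {u v : V} (hu : IsHigh G q u) (hv : IsHigh G q v)
    (h : clusterLabel G ident q κ u ≠ clusterLabel G ident q κ v) :
    ((2 * (κ + 1) - 1 : ℕ) : ℕ∞) ≤ G.edist u v := by
  by_contra! hlt
  obtain ⟨p, hp⟩ := SimpleGraph.exists_walk_of_edist_ne_top (ne_top_of_lt hlt)
  rw [← hp, Nat.cast_lt] at hlt
  refine h (clusterLabel_eq_of_near (x := p.getVert κ) hu hv ?_ ?_)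
  · rw [SimpleGraph.edist_comm]
    refine (SimpleGraph.edist_le (p.take κ)).trans (Nat.cast_le.2 ?_)
    simp
  · refine (SimpleGraph.edist_le (p.drop κ)).trans (Nat.cast_le.2 ?_)
    simp
    omega

/-- The next vertex on a shortest walk to the root qualifies. -/
theorem IsNonRoot.parent_spec {u : V} (h : IsNonRoot G q κ u) :
    (linkGraph G q κ).Adj u (clusterParent G q κ u) ∧
      (linkGraph G q κ).dist (clusterParent G q κ u) (clusterRoot G q κ u) <
        clusterDepth G q κ u := by
  have hex : ∃ p, (linkGraph G q κ).Adj u p ∧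
      (linkGraph G q κ).dist p (clusterRoot G q κ u) < clusterDepth G q κ u := by
    obtain ⟨p, hp⟩ := (reachable_clusterRoot (G := G) (q := q) (κ := κ) u).exists_walk_length_eq_dist
    rw [clusterDepth, ← hp]
    generalize hr : clusterRoot G q κ u = r at p
    cases p with
    | nil => exact absurd hr.symm h.2
    | cons hadj p' =>
      exact ⟨_, hadj, (SimpleGraph.dist_le p').trans_lt (by simp)⟩
  rw [clusterParent, dif_pos hex]
  exact hex.choose_spec

theorem IsNonRoot.mid_spec {u : V} (h : IsNonRoot G q κ u) :
    G.edist (clusterMid G q κ u) u ≤ κ ∧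
      G.edist (clusterMid G q κ u) (clusterParent G q κ u) ≤ κ := by
  have hex := h.parent_spec.1.2.2.2
  rw [clusterMid, dif_pos hex]
  exact hex.choose_spec

theorem IsNonRoot.parent_label {u : V} (h : IsNonRoot G q κ u) :
    clusterLabel G ident q κ (clusterParent G q κ u) = clusterLabel G ident q κ u :=
  (clusterLabel_eq_of_reachable h.1 h.parent_spec.1.reachable).symm

theorem IsNonRoot.parent_depth {u : V} (h : IsNonRoot G q κ u) :
    clusterDepth G q κ (clusterParent G q κ u) < clusterDepth G q κ u := by
  rw [clusterDepth, ← clusterRoot_eq_iff.2 h.parent_spec.1.reachable]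
  exact h.parent_spec.2

theorem clusterDist_le_of_adj {u v : V} (h : G.Adj u v) (B : ℕ) :
    clusterDist G ident q κ B u ≤ clusterDist G ident q κ B v + 1 := by
  rw [clusterDist, clusterDist]
  rcases isEmpty_or_nonempty {u // IsHigh G q u ∧ clusterLabel G ident q κ u = B} with he | he
  · rw [iInf_of_empty, iInf_of_empty]; exact le_top
  rw [ENat.iInf_add]
  refine le_iInf fun w => (iInf_le _ w).trans ?_
  refine (SimpleGraph.edist_triangle (v := v)).trans ?_
  rw [SimpleGraph.edist_eq_one_iff_adj.2 h, add_comm]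

/-- Adjacent vertices are both at finite or both at infinite distance from a cluster, so the default
value creates no jump. -/
theorem clusterFar_le_of_adj {u v : V} (h : G.Adj u v) (B : ℕ) :
    clusterFar G ident q κ B u ≤ clusterFar G ident q κ B v + 1 := by
  have h1 := clusterDist_le_of_adj (ident := ident) (q := q) (κ := κ) h B
  have h2 := clusterDist_le_of_adj (ident := ident) (q := q) (κ := κ) h.symm B
  unfold clusterFar
  split_ifs with hu hv hv
  · omega
  · rw [hu, top_le_iff] at h1
    exact absurd h1 (by simp [hv])
  · rw [hv, top_le_iff] at h2
    exact absurd h2 (by simp [hu])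
  · rw [← ENat.natCast_toNat hu, ← ENat.natCast_toNat hv] at h1
    exact_mod_cast h1

theorem clusterFar_self {u : V} (hu : IsHigh G q u) :
    clusterFar G ident q κ (clusterLabel G ident q κ u) u = 0 := by
  have : clusterDist G ident q κ (clusterLabel G ident q κ u) u = 0 := by
    rw [← nonpos_iff_eq_zero, clusterDist]
    exact (iInf_le _ ⟨u, hu, rfl⟩).trans (by simp)
  simp [clusterFar, this]

theorem le_clusterFar {u : V} (hu : IsHigh G q u) {B : ℕ} (hB : B ≠ clusterLabel G ident q κ u) :
    2 * (κ + 1) - 1 ≤ clusterFar G ident q κ B u := by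
  have h : ((2 * (κ + 1) - 1 : ℕ) : ℕ∞) ≤ clusterDist G ident q κ B u :=
    le_iInf fun w => lt_edist_of_clusterLabel_ne (ident := ident) hu w.2.1
      (by rw [w.2.2]; exact hB.symm)
  unfold clusterFar
  split_ifs with ht
  · exact le_rfl
  · rw [← ENat.natCast_toNat ht] at h
    exact_mod_cast h

/-! ### Numerical bounds and the number of clusters in a finite graph -/

section Finite

variable [Fintype V]

theorem edist_toNat_lt_card {u v : V} (h : G.edist u v ≠ ⊤) :
    (G.edist u v).toNat < Fintype.card V := by
  classical
  obtain ⟨p, hp⟩ := SimpleGraph.exists_walk_of_edist_ne_top h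
  have h1 := SimpleGraph.edist_le p.toPath.1
  rw [← ENat.natCast_toNat h, Nat.cast_le] at h1
  exact h1.trans_lt p.toPath.2.length_lt

theorem clusterDist_toNat_lt_card {B : ℕ} {v : V} (h : clusterDist G ident q κ B v ≠ ⊤) :
    (clusterDist G ident q κ B v).toNat < Fintype.card V := by
  unfold clusterDist at h ⊢
  rcases isEmpty_or_nonempty {u // IsHigh G q u ∧ clusterLabel G ident q κ u = B} with he | he
  · simp at h
  obtain ⟨w, hw⟩ := exists_eq_ciInf_of_finite
    (f := fun u : {u // IsHigh G q u ∧ clusterLabel G ident q κ u = B} => G.edist v u)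
  rw [← hw] at h ⊢
  exact edist_toNat_lt_card h

theorem clusterDepth_lt_card (u : V) : clusterDepth G q κ u < Fintype.card V := by
  have h := (reachable_clusterRoot (G := G) (q := q) (κ := κ) u)
  rw [clusterDepth, SimpleGraph.dist]
  exact edist_toNat_lt_card (SimpleGraph.edist_ne_top_iff_reachable.2 h)

theorem IsInducedPath.le_card {K : V → V → Prop} {t : ℕ} {x : ℕ → V} (h : IsInducedPath K t x) :
    t ≤ Fintype.card V := by
  have : Function.Injective fun i : Fin t => x i := fun i j hij => by
    by_contra hne
    rcases lt_or_gt_of_ne hne with hlt | hlt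
    · exact (h i j hlt j.2).1 hij
    · exact (h j i hlt i.2).1 hij.symm
  simpa using Fintype.card_le_of_injective _ this

open Classical in
theorem clusterReach_le_card (B : ℕ) (v : V) : clusterReach G ident q κ B v ≤ Fintype.card V :=
  Nat.findGreatest_le _

open Classical in
theorem le_clusterReach {B t : ℕ} {x : ℕ → V} (hx : IsInducedPath G.Adj t x)
    (hdec : ∀ i, 0 < i → i < t → clusterFar G ident q κ B (x i) < clusterFar G ident q κ B (x 0)) :
    t ≤ clusterReach G ident q κ B (x 0) :=
  Nat.le_findGreatest hx.le_card ⟨x, rfl, hx, hdec⟩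

open Classical in
theorem exists_isInducedPath_clusterReach (B : ℕ) (v : V) :
    ∃ x : ℕ → V, x 0 = v ∧ IsInducedPath G.Adj (clusterReach G ident q κ B v) x ∧
      ∀ i, 0 < i → i < clusterReach G ident q κ B v →
        clusterFar G ident q κ B (x i) < clusterFar G ident q κ B v :=
  Nat.findGreatest_spec (P := fun t => ∃ x : ℕ → V, x 0 = v ∧ IsInducedPath G.Adj t x ∧
    ∀ i, 0 < i → i < t → clusterFar G ident q κ B (x i) < clusterFar G ident q κ B v)
    (Nat.zero_le _) ⟨fun _ => v, rfl, fun _ _ _ h => by omega, fun _ _ h => by omega⟩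

open Classical in
noncomputable def clusterLabels (G : SimpleGraph V) (ident : V → ℕ) (q κ : ℕ) : Finset ℕ :=
  (Finset.univ.filter fun u => IsHigh G q u).image (clusterLabel G ident q κ)

theorem mem_clusterLabels {u : V} (hu : IsHigh G q u) :
    clusterLabel G ident q κ u ∈ clusterLabels G ident q κ :=
  Finset.mem_image_of_mem _ (by simpa using hu)

theorem clusterDist_eq_top {B : ℕ} (hB : B ∉ clusterLabels G ident q κ) (v : V) :
    clusterDist G ident q κ B v = ⊤ := by
  have : IsEmpty {u // IsHigh G q u ∧ clusterLabel G ident q κ u = B} :=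
    ⟨fun u => hB (u.2.2 ▸ mem_clusterLabels u.2.1)⟩
  simp [clusterDist]

/-- Distinct clusters have disjoint neighbourhoods, hence there are few of them. -/
theorem card_clusterLabels_mul_le (hκ : 1 ≤ κ) :
    (clusterLabels G ident q κ).card * q ≤ Fintype.card V := by
  classical
  have hrep : ∀ B ∈ clusterLabels G ident q κ, ∃ u, IsHigh G q u ∧
      clusterLabel G ident q κ u = B := fun B hB => by
    simpa [clusterLabels] using hB
  rcases isEmpty_or_nonempty V with hV | hV
  · simp [clusterLabels, Finset.univ_eq_empty]
  choose! r hr hrB using hrep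
  have hdisj : Set.PairwiseDisjoint (clusterLabels G ident q κ : Set ℕ)
      fun B => (G.neighborSet (r B)).toFinite.toFinset := by
    intro B hB B' hB' hne
    refine Finset.disjoint_left.2 fun x hx hx' => hne ?_
    simp only [Set.Finite.mem_toFinset, SimpleGraph.mem_neighborSet] at hx hx'
    have hone : ∀ {u}, G.Adj u x → G.edist x u ≤ κ := fun h => by
      rw [SimpleGraph.edist_eq_one_iff_adj.2 h.symm]
      exact_mod_cast hκ
    rw [← hrB B hB, ← hrB B' hB']
    exact clusterLabel_eq_of_near (hr B hB) (hr B' hB') (hone hx) (hone hx')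
  have h1 := Finset.card_biUnion hdisj
  have h2 : (clusterLabels G ident q κ).card • q ≤ ∑ B ∈ clusterLabels G ident q κ,
      (G.neighborSet (r B)).toFinite.toFinset.card :=
    Finset.card_nsmul_le_sum _ _ _ fun B hB => by
      rw [← Set.ncard_eq_toFinset_card]
      exact hr B hB
  rw [smul_eq_mul, ← h1] at h2
  exact h2.trans (Finset.card_le_univ _)

end Finite

end Clusters

/-! ### Honest certificates -/

section Honest

variable {V : Type*} [Fintype V] (G : SimpleGraph V) (ident : V → ℕ) (q κ : ℕ) {m : ℕ}
  (φ cl : V → Fin m)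

open Classical in
/-- The facts about the whole graph that are given to all vertices. -/
noncomputable def commonFacts : FactSet :=
  Finset.univ.image (fun u => (0, ident u, 0, clusterLabel G ident q κ u)) ∪
  (Finset.univ.image (fun u => (1, ident u, 0, clusterDepth G q κ u)) ∪
  (Finset.univ.image (fun u =>
    -- Identifiers are positive, so 0 names no vertex and no comparison is requested for roots and
    -- low vertices.
    (2, ident u, 0, if IsNonRoot G q κ u then ident (clusterMid G q κ u) else 0)) ∪
  (Finset.univ.image (fun u =>
    (3, ident u, 0, if IsNonRoot G q κ u then ident (clusterParent G q κ u) else 0)) ∪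
  ((clusterLabels G ident q κ ×ˢ Finset.univ).image (fun p : ℕ × V => (4, p.1, ident p.2,
    if clusterDist G ident q κ p.1 p.2 = ⊤ then 0
    else (clusterDist G ident q κ p.1 p.2).toNat + 1)) ∪
  ((clusterLabels G ident q κ ×ˢ Finset.univ).image (fun p : ℕ × V => (5, p.1, ident p.2,
    clusterReach G ident q κ p.1 p.2)) ∪
  (Finset.univ.filter fun p : V × V => ¬ IsHigh G q p.1 ∧ G.Adj p.1 p.2).image
    (fun p => (6, ident p.1, ident p.2, 1)))))))

open Classical in
/-- The adjacency lists stored at `w`: those of the vertices whose class is the colour of `w`. -/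
noncomputable def privateFacts (w : V) : FactSet :=
  (Finset.univ.filter fun z => cl z = φ w).image (fun z => (7, ident z, 0, 0)) ∪
  (Finset.univ.filter fun p : V × V => cl p.1 = φ w ∧ G.Adj p.1 p.2).image
    (fun p => (8, ident p.1, ident p.2, 0))

noncomputable def honestFacts (w : V) : FactSet :=
  commonFacts G ident q κ ∪ privateFacts G ident φ cl w

variable {G ident q κ φ cl}

theorem common_honestFacts (w : V) :
    (honestFacts G ident q κ φ cl w).common = commonFacts G ident q κ := by
  classical
  ext ⟨t, a, b, v⟩
  simp only [FactSet.common, Finset.mem_filter, honestFacts, Finset.mem_union]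
  constructor
  · rintro ⟨h | h, ht⟩
    · exact h
    · exfalso
      simp only [privateFacts, Finset.mem_union, Finset.mem_image, Prod.mk.injEq] at h
      rcases h with ⟨_, _, rfl, _⟩ | ⟨_, _, rfl, _⟩ <;> simp at ht
  · intro h
    refine ⟨Or.inl h, ?_⟩
    simp only [commonFacts, Finset.mem_union, Finset.mem_image, Prod.mk.injEq] at h
    rcases h with ⟨_, _, rfl, _⟩ | ⟨_, _, rfl, _⟩ | ⟨_, _, rfl, _⟩ | ⟨_, _, rfl, _⟩ |
      ⟨_, _, rfl, _⟩ | ⟨_, _, rfl, _⟩ | ⟨_, _, rfl, _⟩ <;> simp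

theorem holds_honestFacts (hinj : Function.Injective ident) {w z : V} :
    (honestFacts G ident q κ φ cl w).Holds (ident z) ↔ cl z = φ w := by
  classical
  simp [Holds, honestFacts, commonFacts, privateFacts, hinj.eq_iff]

theorem lists_honestFacts (hinj : Function.Injective ident) {w z : V} {b : ℕ} :
    (honestFacts G ident q κ φ cl w).Lists (ident z) b ↔
      cl z = φ w ∧ ∃ y, G.Adj z y ∧ b = ident y := by
  classical
  simp [FactSet.Lists, honestFacts, commonFacts, privateFacts, hinj.eq_iff, and_assoc, eq_comm]

theorem label_commonFacts (hinj : Function.Injective ident) (u : V) :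
    (commonFacts G ident q κ).label (ident u) = clusterLabel G ident q κ u := by
  classical
  refine val_eq fun w => ?_
  simp [commonFacts, hinj.eq_iff, eq_comm]

theorem exists_of_label_ne_zero {a : ℕ} (h : (commonFacts G ident q κ).label a ≠ 0) :
    ∃ u, a = ident u := by
  classical
  contrapose! h
  refine val_eq_zero fun w => ?_
  simp [commonFacts, fun u => (h u).symm]

theorem depth_commonFacts (hinj : Function.Injective ident) (u : V) :
    (commonFacts G ident q κ).depth (ident u) = clusterDepth G q κ u := by
  classical
  refine val_eq fun w => ?_
  simp [commonFacts, hinj.eq_iff, eq_comm]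

theorem mid_commonFacts (hinj : Function.Injective ident) {u : V} (hu : IsNonRoot G q κ u) :
    (commonFacts G ident q κ).mid (ident u) = ident (clusterMid G q κ u) := by
  classical
  refine val_eq fun w => ?_
  simp [commonFacts, hinj.eq_iff, hu, eq_comm]

theorem exists_of_mid_ne_zero (hinj : Function.Injective ident) {a : ℕ}
    (h : (commonFacts G ident q κ).mid a ≠ 0) : ∃ u, a = ident u ∧ IsNonRoot G q κ u := by
  classical
  contrapose! h
  by_cases ha : ∃ u, a = ident u
  · obtain ⟨u, rfl⟩ := ha
    refine val_eq fun w => ?_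
    simp [commonFacts, hinj.eq_iff, h u rfl, eq_comm]
  · push Not at ha
    refine val_eq_zero fun w => ?_
    simp [commonFacts, fun u => (ha u).symm]

theorem parent_commonFacts (hinj : Function.Injective ident) {u : V} (hu : IsNonRoot G q κ u) :
    (commonFacts G ident q κ).parent (ident u) = ident (clusterParent G q κ u) := by
  classical
  refine val_eq fun w => ?_
  simp [commonFacts, hinj.eq_iff, hu, eq_comm]

theorem far_commonFacts (hinj : Function.Injective ident) (B : ℕ) (u : V) :
    (commonFacts G ident q κ).far (κ + 1) B (ident u) = clusterFar G ident q κ B u := by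
  classical
  by_cases hB : B ∈ clusterLabels G ident q κ
  · have hval : (commonFacts G ident q κ).val 4 B (ident u) =
        if clusterDist G ident q κ B u = ⊤ then 0
        else (clusterDist G ident q κ B u).toNat + 1 := by
      refine val_eq fun w => ?_
      simp [commonFacts, hinj.eq_iff, hB, eq_comm]
    rw [far, hval, clusterFar]
    split_ifs <;> simp_all
  · have hval : (commonFacts G ident q κ).val 4 B (ident u) = 0 := by
      refine val_eq_zero fun w => ?_
      simp only [commonFacts, Finset.mem_union, Finset.mem_image, Prod.mk.injEq, Prod.exists,
        Finset.mem_product]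
      simp
      grind
    rw [far, hval, clusterFar, clusterDist_eq_top hB]
    simp

theorem reach_commonFacts (hinj : Function.Injective ident) {B : ℕ}
    (hB : B ∈ clusterLabels G ident q κ) (u : V) :
    (commonFacts G ident q κ).reach B (ident u) = clusterReach G ident q κ B u := by
  classical
  refine val_eq fun w => ?_
  simp [commonFacts, hinj.eq_iff, hB, eq_comm]

/-- The nonvanishing hypothesis of `combine` restricts that check to labels of actual clusters. -/
theorem mem_clusterLabels_of_reach_ne_zero {B a : ℕ}
    (h : (commonFacts G ident q κ).reach B a ≠ 0) : B ∈ clusterLabels G ident q κ := by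
  classical
  contrapose! h
  refine val_eq_zero fun w => ?_
  simp only [commonFacts, Finset.mem_union, Finset.mem_image, Prod.mk.injEq, Prod.exists,
    Finset.mem_product]
  simp
  grind

theorem lowAdj_commonFacts (hinj : Function.Injective ident) {u : V} {b : ℕ} :
    (commonFacts G ident q κ).LowAdj (ident u) b ↔
      ¬ IsHigh G q u ∧ ∃ w, G.Adj u w ∧ b = ident w := by
  classical
  simp [LowAdj, commonFacts, hinj.eq_iff, and_assoc, eq_comm]

end Honest

/-! ### Completeness -/

/-- What a vertex `v` sees at least of its neighbourhood up to distance `κ + 1`. -/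
structure SeesNear {V : Type*} (G : SimpleGraph V) (ident : V → ℕ) (κ : ℕ) (F : V → FactSet)
    (v : V) (E : ℕ → ℕ → Prop) (L : ℕ → FactSet → Prop) : Prop where
  edge : ∀ b, E (ident v) b ↔ ∃ w, G.Adj v w ∧ b = ident w
  of_label : ∀ a F', L a F' → ∃ w, a = ident w ∧ F' = F w
  edge_near : ∀ u w, G.edist v u ≤ κ → G.Adj u w → E (ident u) (ident w) ∧ L (ident w) (F w)
  label_near : ∀ u, G.edist v u ≤ κ → L (ident u) (F u)

section Completeness

variable {V : Type*} {G : SimpleGraph V} {ident : V → ℕ} {q κ m : ℕ}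
  {φ cl : V → Fin m} {v : V} {E : ℕ → ℕ → Prop} {L : ℕ → FactSet → Prop}

theorem SeesNear.label_adj {F : V → FactSet} (hS : SeesNear G ident κ F v E L) {w : V}
    (h : G.Adj v w) : L (ident w) (F w) :=
  (hS.edge_near v w (by simp) h).2

theorem SeesNear.eq_of_label {F : V → FactSet} (hS : SeesNear G ident κ F v E L)
    (hinj : Function.Injective ident) {w : V} {F' : FactSet} (h : L (ident w) F') : F' = F w := by
  obtain ⟨w', h1, h2⟩ := hS.of_label _ _ h
  rw [h2, hinj h1]

/-- Two induced paths that are separated by a level of a function with small steps can be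
concatenated. -/
theorem IsInducedPath.append {f : V → ℕ} (hf : ∀ a b, G.Adj a b → f a ≤ f b + 1)
    {s t : ℕ} {x y : ℕ → V} (hx : IsInducedPath G.Adj (t + 1) x) (hy : IsInducedPath G.Adj s y)
    (hxy : x t = y 0) (hxf : ∀ i < t, f (x t) < f (x i))
    (hyf : ∀ i, 0 < i → i < s → f (y i) < f (y 0)) :
    IsInducedPath G.Adj (t + s) fun i => if i < t then x i else y (i - t) := by
  intro i j hij hj
  by_cases hi : i < t
  · by_cases hjt : j < t
    · simpa only [hi, hjt, if_true] using hx i j hij (by omega)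
    · simp only [hi, hjt, if_true, if_false]
      rcases (not_lt.1 hjt).eq_or_lt with rfl | hjt
      · rw [Nat.sub_self, ← hxy]
        exact hx i t hij (by omega)
      · have h1 := hxf i hi
        have h2 := hyf (j - t) (by omega) (by omega)
        rw [hxy] at h1
        -- The levels of the two vertices lie strictly on either side of the level of the junction,
        -- so they differ by at least two: the vertices are neither equal nor adjacent.
        refine ⟨fun h => by rw [h] at h1; omega, fun h => ?_, fun h => by omega⟩
        have := hf _ _ h
        omega
  · have hjt : ¬ j < t := by omega
    simp only [hi, hjt, if_false]
    have h := hy (i - t) (j - t) (by omega) (by omega)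
    exact ⟨h.1, h.2.trans (by omega)⟩

variable [Fintype V]

/-- A high v has a neighbour of each colour, hence one that stores the list of u. Adjacent high
vertices are always in one cluster since κ ≥ 1. -/
theorem SeesNear.knownAdj_iff (hS : SeesNear G ident κ (honestFacts G ident q κ φ cl) v E L)
    (hinj : Function.Injective ident) (hid : ∀ v, 1 ≤ ident v)
    (hcol : ∀ u, IsHigh G q u → ∀ i, ∃ w, G.Adj u w ∧ φ w = i) (hκ : 1 ≤ κ) {u w : V}
    (huw : clusterLabel G ident q κ u = clusterLabel G ident q κ w →
      clusterLabel G ident q κ u = 1 ∨ clusterLabel G ident q κ u = clusterLabel G ident q κ v) :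
    KnownAdj (ident v) E L (commonFacts G ident q κ) (ident u) (ident w) ↔ G.Adj u w := by
  have hex : ∀ a b : V, (∃ y, G.Adj a y ∧ ident b = ident y) ↔ G.Adj a b := fun a b =>
    ⟨fun ⟨y, h, hy⟩ => hinj hy ▸ h, fun h => ⟨b, h, rfl⟩⟩
  unfold KnownAdj
  simp only [label_commonFacts hinj, lowAdj_commonFacts hinj, hex]
  by_cases hu : clusterLabel G ident q κ u = 1
  · simp [hu, (clusterLabel_eq_one_iff hid).1 hu]
  by_cases hw : clusterLabel G ident q κ w = 1
  · simp [hu, hw, (clusterLabel_eq_one_iff hid).1 hw, G.adj_comm]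
  simp only [hu, hw, false_and, ne_eq, not_false_eq_true, true_and, false_or]
  have hhigh : ∀ {a}, clusterLabel G ident q κ a ≠ 1 → IsHigh G q a := fun h => by
    rwa [ne_eq, clusterLabel_eq_one_iff hid, not_not] at h
  by_cases huw' : clusterLabel G ident q κ u = clusterLabel G ident q κ w
  · have hv := (huw huw').resolve_left hu
    refine ⟨fun ⟨_, a, F, hE, hL, h1, h2⟩ => ?_, fun h => ⟨huw', ?_⟩⟩
    · obtain ⟨a, -, rfl⟩ := (hS.edge _).1 hE
      obtain rfl := hS.eq_of_label hinj hL
      exact (hex _ _).1 ((lists_honestFacts hinj).1 h2).2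
    · obtain ⟨a, ha, hc⟩ := hcol v (hhigh (hv ▸ hu)) (cl u)
      exact ⟨_, _, (hS.edge _).2 ⟨a, ha, rfl⟩, hS.label_adj ha, (holds_honestFacts hinj).2 hc.symm,
        (lists_honestFacts hinj).2 ⟨hc.symm, w, h, rfl⟩⟩
  · simp only [huw', false_and, false_iff]
    intro hadj
    refine huw' (clusterLabel_eq_of_near (x := u) (hhigh hu) (hhigh hw) (by simp) ?_)
    rw [SimpleGraph.edist_eq_one_iff_adj.2 hadj]
    exact_mod_cast hκ

/-- The checks range over arbitrary sequences of numbers; a nonzero label shows that a number names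
a vertex, so these sequences are genuine induced paths. -/
theorem SeesNear.exists_isInducedPath
    (hS : SeesNear G ident κ (honestFacts G ident q κ φ cl) v E L)
    (hinj : Function.Injective ident) (hid : ∀ v, 1 ≤ ident v)
    (hcol : ∀ u, IsHigh G q u → ∀ i, ∃ w, G.Adj u w ∧ φ w = i) (hκ : 1 ≤ κ) {t : ℕ} {x : ℕ → ℕ}
    (hx : ∀ i < t, (commonFacts G ident q κ).label (x i) ≠ 0)
    (hlab : ∀ i j, i < j → j < t →
      (commonFacts G ident q κ).label (x i) = (commonFacts G ident q κ).label (x j) →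
      (commonFacts G ident q κ).label (x i) = 1 ∨
        (commonFacts G ident q κ).label (x i) = (commonFacts G ident q κ).label (ident v))
    (hpath : IsInducedPath (KnownAdj (ident v) E L (commonFacts G ident q κ)) t x) :
    ∃ y : ℕ → V, (∀ i < t, x i = ident (y i)) ∧ IsInducedPath G.Adj t y := by
  have hy : ∀ i, ∃ u, i < t → x i = ident u := fun i => by
    by_cases hi : i < t
    · obtain ⟨u, hu⟩ := exists_of_label_ne_zero (hx i hi)
      exact ⟨u, fun _ => hu⟩
    · exact ⟨v, fun h => absurd h hi⟩
  choose y hy using hy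
  refine ⟨y, hy, fun i j hij hj => ?_⟩
  have h := hpath i j hij hj
  have hl := hlab i j hij hj
  rw [hy i (by omega), hy j hj] at h hl
  simp only [label_commonFacts hinj] at hl
  exact ⟨fun h' => h.1 (h' ▸ rfl), (hS.knownAdj_iff hinj hid hcol hκ hl).symm.trans h.2⟩

theorem SeesNear.accepts (hS : SeesNear G ident κ (honestFacts G ident q κ φ cl) v E L)
    (hinj : Function.Injective ident) (hid : ∀ v, 1 ≤ ident v)
    (hcol : ∀ u, IsHigh G q u → ∀ i, ∃ w, G.Adj u w ∧ φ w = i) (hκ : 1 ≤ κ)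
    (hfree : ∀ y : ℕ → V, ¬ IsInducedPath G.Adj (4 * (κ + 1) - 1) y) :
    Accepts (κ + 1) (ident v) E L (commonFacts G ident q κ) := by
  have hhigh : ∀ {a}, (commonFacts G ident q κ).label (ident a) ≠ 1 → IsHigh G q a := fun h => by
    rwa [label_commonFacts hinj, ne_eq, clusterLabel_eq_one_iff hid, not_not] at h
  have hhighz : ∀ {a z}, IsHigh G q a → (commonFacts G ident q κ).label z =
      clusterLabel G ident q κ a → ∃ b, z = ident b := fun h hz =>
    exists_of_label_ne_zero (hz ▸ clusterLabel_ne_zero _)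
  refine ⟨?common, ?vertex, ?low, ?lipschitz, ?far_self, ?far_other, ?holder, ?agree, ?own, ?link,
    ?middle, ?free, ?near, ?combine⟩
  case common =>
    intro w F _ hL
    obtain ⟨u, -, rfl⟩ := hS.of_label _ _ hL
    exact common_honestFacts u
  case vertex =>
    rw [label_commonFacts hinj]
    exact clusterLabel_ne_zero v
  case low =>
    intro h w
    rw [label_commonFacts hinj, clusterLabel_eq_one_iff hid] at h
    rw [lowAdj_commonFacts hinj, hS.edge]
    simp [h]
  case lipschitz =>
    intro w hE B
    obtain ⟨w, hw, rfl⟩ := (hS.edge _).1 hE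
    rw [far_commonFacts hinj, far_commonFacts hinj]
    exact clusterFar_le_of_adj hw B
  case far_self =>
    intro h
    rw [far_commonFacts hinj, label_commonFacts hinj]
    exact clusterFar_self (hhigh h)
  case far_other =>
    intro h B hB
    rw [label_commonFacts hinj] at hB
    rw [far_commonFacts hinj]
    exact le_clusterFar (hhigh h) hB
  case holder =>
    intro h z hz
    rw [label_commonFacts hinj v] at hz
    obtain ⟨z, rfl⟩ := hhighz (hhigh h) hz
    obtain ⟨a, ha, hc⟩ := hcol v (hhigh h) (cl z)
    exact ⟨_, _, (hS.edge _).2 ⟨a, ha, rfl⟩, hS.label_adj ha, (holds_honestFacts hinj).2 hc.symm⟩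
  case agree =>
    intro h z hz w F w' F' _ hL _ hL' hh hh' b hb
    rw [label_commonFacts hinj v] at hz
    obtain ⟨z, rfl⟩ := hhighz (hhigh h) hz
    obtain ⟨w, -, rfl⟩ := hS.of_label _ _ hL
    obtain ⟨w', -, rfl⟩ := hS.of_label _ _ hL'
    exact (lists_honestFacts hinj).2
      ⟨(holds_honestFacts hinj).1 hh', ((lists_honestFacts hinj).1 hb).2⟩
  case own =>
    intro h w F _ hL hh b
    obtain ⟨w, -, rfl⟩ := hS.of_label _ _ hL
    rw [lists_honestFacts hinj, hS.edge]
    simp [(holds_honestFacts hinj).1 hh]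
  case link =>
    intro h
    by_cases hr : v = clusterRoot G q κ v
    · left
      rw [label_commonFacts hinj, (hhigh h).clusterLabel_eq, ← hr]
    · right
      have hnr : IsNonRoot G q κ v := ⟨hhigh h, hr⟩
      rw [mid_commonFacts hinj hnr, parent_commonFacts hinj hnr, label_commonFacts hinj,
        label_commonFacts hinj, depth_commonFacts hinj, depth_commonFacts hinj]
      refine ⟨⟨_, hS.label_near _ ?_⟩, hnr.parent_label, hnr.parent_depth⟩
      rw [SimpleGraph.edist_comm]
      exact hnr.mid_spec.1
  case middle =>
    intro u hu z hz
    obtain ⟨u, rfl, hnr⟩ := exists_of_mid_ne_zero hinj (by rw [hu]; exact Nat.one_le_iff_ne_zero.1 (hid v))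
    rw [mid_commonFacts hinj hnr] at hu
    have hmid := hnr.mid_spec
    rw [hinj hu] at hmid
    rw [label_commonFacts hinj u] at hz
    obtain ⟨z, rfl⟩ := hhighz hnr.1 hz
    obtain ⟨a, ha, hc⟩ := hcol u hnr.1 (cl z)
    obtain ⟨a', ha', hc'⟩ := hcol _ hnr.parent_spec.1.2.2.1 (cl z)
    obtain ⟨h1, h2⟩ := hS.edge_near _ _ hmid.1 ha
    obtain ⟨h3, h4⟩ := hS.edge_near _ _ hmid.2 ha'
    rw [parent_commonFacts hinj hnr]
    refine ⟨_, _, _, _, h1, h2, h3, h4, (holds_honestFacts hinj).2 hc.symm,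
      (holds_honestFacts hinj).2 hc'.symm, fun b => ?_⟩
    rw [lists_honestFacts hinj, lists_honestFacts hinj, hc, hc']
  case free =>
    intro x hx hpath
    by_contra! hcon
    obtain ⟨y, -, hy⟩ := hS.exists_isInducedPath hinj hid hcol hκ hx (fun i j hij hj hlab => by
      by_contra! h
      exact h.2 (hcon i j hij hj hlab h.1)) hpath
    exact hfree y hy
  case near =>
    intro h x t hlab hpath hdec
    obtain ⟨y, hxy, hy⟩ := hS.exists_isInducedPath hinj hid hcol hκ
      (fun i hi => by
        have := clusterLabel_ne_zero (G := G) (ident := ident) (q := q) (κ := κ) v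
        rw [← label_commonFacts hinj] at this
        rcases hlab i (by omega) with h | h <;> omega)
      (fun i j hij hj _ => hlab i (by omega)) hpath
    have hreach := le_clusterReach (ident := ident) (q := q) (κ := κ)
      (B := clusterLabel G ident q κ v) hy (fun i hi hi' => by
        have := hdec i hi (by omega)
        rwa [hxy i hi', hxy 0 (by omega), label_commonFacts hinj, far_commonFacts hinj,
          far_commonFacts hinj] at this)
    rwa [hxy 0 (by omega), label_commonFacts hinj,
      reach_commonFacts hinj (mem_clusterLabels (hhigh h))]
  case combine =>
    intro h B hB x t hlab hpath hdec hne
    obtain ⟨y, hxy, hy⟩ := hS.exists_isInducedPath hinj hid hcol hκ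
      (fun i hi => by
        have := clusterLabel_ne_zero (G := G) (ident := ident) (q := q) (κ := κ) v
        rw [← label_commonFacts hinj] at this
        rcases hlab i (by omega) with h | h <;> omega)
      (fun i j hij hj _ => hlab i (by omega)) hpath
    have hBm := mem_clusterLabels_of_reach_ne_zero hne
    rw [hxy t (by omega), reach_commonFacts hinj hBm]
    obtain ⟨z, hz0, hz, hzdec⟩ := exists_isInducedPath_clusterReach (G := G) (ident := ident)
      (q := q) (κ := κ) B (y t)
    -- Otherwise the prefix and a path realizing the recorded reach join to an induced path on at
    -- least 4k - 1 vertices.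
    by_contra! hlong
    refine hfree _ (IsInducedPath.mono (IsInducedPath.append (f := clusterFar G ident q κ B)
      (fun a b hab => clusterFar_le_of_adj hab B) hy hz hz0.symm (fun i hi => ?_) ?_) hlong)
    · have := hdec i hi
      rwa [hxy i (by omega), hxy t (by omega), far_commonFacts hinj, far_commonFacts hinj] at this
    · rw [hz0]
      exact hzdec

end Completeness

/-! ### Size of the certificates -/

section Size

/-- The number of colours used on graphs with `n` vertices. -/
def colorCount (n : ℕ) : ℕ := max 1 (Nat.sqrt n / (2 * (Nat.log 2 n + 1)))

theorem colorCount_pos (n : ℕ) : 0 < colorCount n := lt_of_lt_of_le one_pos (le_max_left _ _)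

/-- With m colours, l = ⌊log₂ n⌋ + 1 and √n ≥ 2lm, one has (1 - 1/m)^√n ≤ 2^(-2l) < 1/n² ≤ 1/(nm).
For m = 1 the left side vanishes. -/
theorem mul_colorCount_mul_pow_lt (n : ℕ) :
    n * colorCount n * (colorCount n - 1) ^ Nat.sqrt n < colorCount n ^ Nat.sqrt n := by
  have hpos := colorCount_pos n
  rcases Nat.eq_zero_or_pos n with rfl | hn
  · simp
  have hq : 0 < Nat.sqrt n := Nat.sqrt_pos.2 hn
  rcases (Nat.succ_le_iff.2 hpos).eq_or_lt with h1 | h1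
  · rw [← h1]
    simp [hq.ne']
  have hm : colorCount n = Nat.sqrt n / (2 * (Nat.log 2 n + 1)) := by
    unfold colorCount at h1 ⊢
    omega
  set l := Nat.log 2 n + 1 with hl
  set m := colorCount n with hmdef
  have hle : m * (2 * l) ≤ Nat.sqrt n := hm ▸ Nat.div_mul_le_self _ _
  have hnl : n < 2 ^ l := Nat.lt_pow_succ_log_self one_lt_two n
  have hmn : m ≤ n := hm ▸ (Nat.div_le_self _ _).trans (Nat.sqrt_le_self n)
  obtain ⟨r, hr⟩ := Nat.exists_eq_add_of_le hle
  have hpow : 2 ^ (2 * l) * (m - 1) ^ Nat.sqrt n ≤ m ^ Nat.sqrt n := by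
    calc 2 ^ (2 * l) * (m - 1) ^ Nat.sqrt n
        = (2 * (m - 1) ^ m) ^ (2 * l) * (m - 1) ^ r := by
          rw [hr, pow_add, mul_pow, ← pow_mul, mul_assoc]
      _ ≤ (m ^ m) ^ (2 * l) * m ^ r := by
          gcongr
          · exact two_mul_pow_pred_le hpos
          · omega
      _ = _ := by rw [hr, pow_add, ← pow_mul]
  refine lt_of_lt_of_le (Nat.mul_lt_mul_of_pos_right ?_ (Nat.pow_pos (by omega))) hpow
  calc n * m ≤ n * n := Nat.mul_le_mul_left _ hmn
    _ < 2 ^ l * 2 ^ l := Nat.mul_lt_mul'' hnl hnl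
    _ = _ := by rw [← pow_add, two_mul]

/-- Few colours would mean large classes; this bounds the n / m lists of a class by O(√n log n). -/
theorem le_mul_colorCount {n : ℕ} :
    n ≤ 12 * (Nat.log 2 n + 1) * Nat.sqrt n * colorCount n := by
  rcases Nat.eq_zero_or_pos n with rfl | hn
  · simp
  have hq : 0 < Nat.sqrt n := Nat.sqrt_pos.2 hn
  have hpos := colorCount_pos n
  have h1 : Nat.sqrt n < 2 * (Nat.log 2 n + 1) * (colorCount n + 1) := by
    refine lt_of_lt_of_le (Nat.lt_mul_div_succ (Nat.sqrt n)
      (show 0 < 2 * (Nat.log 2 n + 1) by omega)) (Nat.mul_le_mul_left _ ?_)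
    exact Nat.succ_le_succ (le_max_right _ _)
  have h2 : Nat.sqrt n ≤ 4 * (Nat.log 2 n + 1) * colorCount n := by nlinarith
  have h3 := Nat.sqrt_le_add n
  calc n ≤ 3 * Nat.sqrt n * Nat.sqrt n := by nlinarith
    _ ≤ 3 * Nat.sqrt n * (4 * (Nat.log 2 n + 1) * colorCount n) := Nat.mul_le_mul_left _ h2
    _ = _ := by ring

/-- Number the vertices and colour by residue modulo m; within a residue class the quotient
determines the vertex. -/
theorem exists_balanced_coloring (V : Type*) [Fintype V] {m : ℕ} (hm : 0 < m) :
    ∃ cl : V → Fin m, ∀ i, ((Finset.univ.filter fun z => cl z = i).card) ≤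
      Fintype.card V / m + 1 := by
  let e := Fintype.equivFin V
  refine ⟨fun v => ⟨e v % m, Nat.mod_lt _ hm⟩, fun i => ?_⟩
  rw [← Finset.card_range (Fintype.card V / m + 1)]
  refine Finset.card_le_card_of_injOn (fun v => (e v : ℕ) / m) (fun v _ => ?_) ?_
  · simp only [Finset.coe_range, Set.mem_Iio]
    exact Nat.lt_succ_of_le (Nat.div_le_div_right (e v).2.le)
  · intro v hv w hw hvw
    simp only [Finset.coe_filter, Finset.mem_univ, true_and, Set.mem_ofPred_eq] at hv hw hvw
    have h : (e v : ℕ) % m = (e w : ℕ) % m := by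
      have := hv.trans hw.symm
      simpa using this
    apply e.injective
    ext
    rw [← Nat.div_add_mod (e v : ℕ) m, ← Nat.div_add_mod (e w : ℕ) m, h, hvw]

variable {V : Type*} [Fintype V] {G : SimpleGraph V} {ident : V → ℕ} {q κ m : ℕ}
  {φ cl : V → Fin m}

theorem card_commonFacts_le : (commonFacts G ident q κ).card ≤
    4 * Fintype.card V + 2 * ((clusterLabels G ident q κ).card * Fintype.card V) +
      q * Fintype.card V := by
  classical
  have hV : ∀ f : V → ℕ × ℕ × ℕ × ℕ, (Finset.univ.image f).card ≤ Fintype.card V := fun f =>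
    Finset.card_image_le
  have hB : ∀ f : ℕ × V → ℕ × ℕ × ℕ × ℕ, ((clusterLabels G ident q κ ×ˢ Finset.univ).image f).card ≤
      (clusterLabels G ident q κ).card * Fintype.card V := fun f =>
    Finset.card_image_le.trans_eq (Finset.card_product _ _)
  have hlow : ∀ f : V × V → ℕ × ℕ × ℕ × ℕ, ((Finset.univ.filter fun p : V × V =>
      ¬ IsHigh G q p.1 ∧ G.Adj p.1 p.2).image f).card ≤ q * Fintype.card V := by
    intro f
    refine Finset.card_image_le.trans ((Finset.card_le_mul_card_image (f := Prod.fst) _ q ?_).trans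
      (Nat.mul_le_mul_left _ (Finset.card_le_univ _)))
    intro u hu
    obtain ⟨p, hp, rfl⟩ := Finset.mem_image.1 hu
    have hp1 := (Finset.mem_filter.1 hp).2.1
    rw [IsHigh, not_le, Set.ncard_eq_toFinset_card] at hp1
    refine le_trans ?_ hp1.le
    refine Finset.card_le_card_of_injOn Prod.snd (fun p' hp' => ?_) ?_
    · simp only [Finset.coe_filter, Finset.mem_filter, Finset.mem_univ, true_and,
        Set.mem_ofPred_eq] at hp'
      simpa [← hp'.2] using hp'.1.2
    · intro a ha b hb hab
      simp only [Finset.coe_filter, Finset.mem_filter, Finset.mem_univ, true_and,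
        Set.mem_ofPred_eq] at ha hb
      exact Prod.ext (ha.2.trans hb.2.symm) hab
  unfold commonFacts
  have hU : ∀ {A B : FactSet} {a b : ℕ}, A.card ≤ a → B.card ≤ b → (A ∪ B).card ≤ a + b :=
    fun h h' => (Finset.card_union_le _ _).trans (Nat.add_le_add h h')
  refine (hU (hV _) (hU (hV _) (hU (hV _) (hU (hV _) (hU (hB _) (hU (hB _) (hlow _))))))).trans ?_
  omega

theorem card_privateFacts_le {f : ℕ} (hcl : ∀ i, (Finset.univ.filter fun z => cl z = i).card ≤ f)
    (w : V) : (privateFacts G ident φ cl w).card ≤ f + f * Fintype.card V := by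
  classical
  unfold privateFacts
  refine (Finset.card_union_le _ _).trans (Nat.add_le_add ?_ ?_)
  · refine Finset.card_image_le.trans (le_of_eq_of_le ?_ (hcl (φ w)))
    congr
  · refine Finset.card_image_le.trans ?_
    refine (Finset.card_le_card (t := (Finset.univ.filter fun z => cl z = φ w) ×ˢ Finset.univ)
      fun p hp => ?_).trans ?_
    · simp only [Finset.mem_filter, Finset.mem_univ, true_and] at hp
      simp [hp.1]
    · rw [Finset.card_product, Finset.card_univ]
      exact Nat.mul_le_mul_right _ (hcl _)

/-- All entries of an honest certificate are polynomial in the number of vertices. -/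
theorem le_of_mem_honestFacts {M : ℕ} (hM : ∀ u, ident u ≤ M) {w : V} {p : ℕ × ℕ × ℕ × ℕ}
    (hp : p ∈ honestFacts G ident q κ φ cl w) :
    p.1 ≤ M + Fintype.card V + 8 ∧ p.2.1 ≤ M + Fintype.card V + 8 ∧
      p.2.2.1 ≤ M + Fintype.card V + 8 ∧ p.2.2.2 ≤ M + Fintype.card V + 8 := by
  classical
  have hlab : ∀ u, clusterLabel G ident q κ u ≤ M + 1 := fun u => by
    unfold clusterLabel
    have := hM (clusterRoot G q κ u)
    split_ifs <;> omega
  have hB : ∀ B ∈ clusterLabels G ident q κ, B ≤ M + 1 := fun B hB => by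
    obtain ⟨u, -, rfl⟩ := Finset.mem_image.1 hB
    exact hlab u
  simp only [honestFacts, commonFacts, privateFacts, Finset.mem_union, Finset.mem_image] at hp
  rcases hp with (⟨u, -, rfl⟩ | ⟨u, -, rfl⟩ | ⟨u, -, rfl⟩ | ⟨u, -, rfl⟩ | ⟨x, hx, rfl⟩ |
    ⟨x, hx, rfl⟩ | ⟨x, -, rfl⟩) | ⟨u, -, rfl⟩ | ⟨x, -, rfl⟩
  · have := hM u; have := hlab u
    refine ⟨?_, ?_, ?_, ?_⟩ <;> dsimp only <;> omega
  · have := hM u; have := clusterDepth_lt_card (G := G) (q := q) (κ := κ) u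
    refine ⟨?_, ?_, ?_, ?_⟩ <;> dsimp only <;> omega
  · have := hM u; have := hM (clusterMid G q κ u)
    refine ⟨?_, ?_, ?_, ?_⟩ <;> dsimp only <;> first | omega | (split_ifs <;> omega)
  · have := hM u; have := hM (clusterParent G q κ u)
    refine ⟨?_, ?_, ?_, ?_⟩ <;> dsimp only <;> first | omega | (split_ifs <;> omega)
  · have := hM x.2; have := hB x.1 (Finset.mem_product.1 hx).1
    refine ⟨?_, ?_, ?_, ?_⟩ <;> dsimp only
    iterate 3 omega
    split_ifs with h
    · omega
    · have := clusterDist_toNat_lt_card h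
      omega
  · have := hM x.2; have := hB x.1 (Finset.mem_product.1 hx).1
    have := clusterReach_le_card (G := G) (ident := ident) (q := q) (κ := κ) x.1 x.2
    refine ⟨?_, ?_, ?_, ?_⟩ <;> dsimp only <;> omega
  · have := hM x.1; have := hM x.2
    refine ⟨?_, ?_, ?_, ?_⟩ <;> dsimp only <;> omega
  · have := hM u
    refine ⟨?_, ?_, ?_, ?_⟩ <;> dsimp only <;> omega
  · have := hM x.1; have := hM x.2
    refine ⟨?_, ?_, ?_, ?_⟩ <;> dsimp only <;> omega

/-- The size of the certificates. -/
def certSize (c n : ℕ) : ℕ :=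
  37 * (8 * c + 44) * (Nat.log 2 n + 1) ^ 2 * Nat.sqrt n * n

/-- Entries are below 2^s with s = l(c+1) + 4, where l = ⌊log₂ n⌋ + 1, and 8s + 4 ≤ (8c + 44) l. -/
theorem length_encode_le_of_le {c n : ℕ} {F : FactSet} {N : ℕ} (hcard : F.card ≤ N)
    (hF : ∀ p ∈ F, p.1 ≤ n ^ c + n + 8 ∧ p.2.1 ≤ n ^ c + n + 8 ∧ p.2.2.1 ≤ n ^ c + n + 8 ∧
      p.2.2.2 ≤ n ^ c + n + 8) :
    (encode F).length ≤ N * ((8 * c + 44) * (Nat.log 2 n + 1)) := by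
  set l := Nat.log 2 n + 1 with hl
  have hnl : n < 2 ^ l := Nat.lt_pow_succ_log_self one_lt_two n
  have hbig : n ^ c + n + 8 < 2 ^ (l * (c + 1) + 4) := by
    have h1 : n ^ c ≤ 2 ^ (l * (c + 1)) :=
      (Nat.pow_le_pow_left hnl.le c).trans (by
        rw [← pow_mul]
        exact Nat.pow_le_pow_right two_pos (Nat.mul_le_mul_left _ (Nat.le_succ c)))
    have h2 : 2 ^ l ≤ 2 ^ (l * (c + 1)) :=
      Nat.pow_le_pow_right two_pos (Nat.le_mul_of_pos_right _ (Nat.succ_pos c))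
    have h3 := Nat.one_le_two_pow (n := l * (c + 1))
    rw [pow_add]
    omega
  refine (length_encode_le (s := l * (c + 1) + 4) fun p hp => ?_).trans (Nat.mul_le_mul hcard ?_)
  · obtain ⟨h1, h2, h3, h4⟩ := hF p hp
    exact ⟨h1.trans_lt hbig, h2.trans_lt hbig, h3.trans_lt hbig, h4.trans_lt hbig⟩
  · have : 1 ≤ l := by omega
    nlinarith

theorem length_encode_honestFacts_le {c : ℕ} (hid : ∀ u, ident u ≤ Fintype.card V ^ c)
    {φ cl : V → Fin (colorCount (Fintype.card V))}
    (hcl : ∀ i, (Finset.univ.filter fun z => cl z = i).card ≤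
      Fintype.card V / colorCount (Fintype.card V) + 1) (hκ : 1 ≤ κ) (w : V) :
    (encode (honestFacts G ident (Nat.sqrt (Fintype.card V)) κ φ cl w)).length ≤
      certSize c (Fintype.card V) := by
  have hlabels := card_clusterLabels_mul_le (G := G) (ident := ident)
    (q := Nat.sqrt (Fintype.card V)) hκ
  have h1 := card_commonFacts_le (G := G) (ident := ident) (q := Nat.sqrt (Fintype.card V)) (κ := κ)
  have h2 := card_privateFacts_le (G := G) (ident := ident) (φ := φ) hcl w
  have hn : 0 < Fintype.card V := Fintype.card_pos_iff.2 ⟨w⟩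
  -- With X = (⌊log₂ n⌋ + 1)⌊√n⌋, the count 37 is 4 + 2·3 + 1 for the common facts, as there are at
  -- most 3X clusters, plus 13 + 13 for the private ones, as a class has at most 13X vertices.
  have hcard : (honestFacts G ident (Nat.sqrt (Fintype.card V)) κ φ cl w).card ≤
      37 * (Nat.log 2 (Fintype.card V) + 1) * Nat.sqrt (Fintype.card V) * Fintype.card V := by
    refine (Finset.card_union_le _ _).trans ((Nat.add_le_add h1 h2).trans ?_)
    have hdiv : Fintype.card V / colorCount (Fintype.card V) ≤
        12 * (Nat.log 2 (Fintype.card V) + 1) * Nat.sqrt (Fintype.card V) :=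
      Nat.div_le_of_le_mul (by rw [mul_comm]; exact le_mul_colorCount)
    have hq : 0 < Nat.sqrt (Fintype.card V) := Nat.sqrt_pos.2 hn
    have hsq := Nat.sqrt_le_add (Fintype.card V)
    generalize Fintype.card V / colorCount (Fintype.card V) = d at *
    generalize Nat.sqrt (Fintype.card V) = q at *
    generalize (clusterLabels G ident q κ).card = b at *
    generalize Nat.log 2 (Fintype.card V) = l at *
    generalize Fintype.card V = n at *
    have hb : b ≤ q + 2 := by
      have : b * q ≤ (q + 2) * q := by nlinarith
      exact Nat.le_of_mul_le_mul_right this hq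
    have hX : q ≤ (l + 1) * q := Nat.le_mul_of_pos_left _ (Nat.succ_pos l)
    have e1 : 37 * (l + 1) * q * n = 37 * ((l + 1) * q) * n := by ring
    have e2 : d ≤ 12 * ((l + 1) * q) := by rw [← mul_assoc]; exact hdiv
    rw [e1]
    generalize (l + 1) * q = X at *
    have hbn : b * n ≤ (3 * X) * n := Nat.mul_le_mul_right _ (by omega)
    have hqn : q * n ≤ X * n := Nat.mul_le_mul_right _ hX
    have hdn : (d + 1) * n ≤ (13 * X) * n := Nat.mul_le_mul_right _ (by omega)
    have hd1 : d + 1 ≤ (13 * X) * n := (by omega : d + 1 ≤ 13 * X).trans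
      (Nat.le_mul_of_pos_right _ hn)
    have hnX : n ≤ X * n := Nat.le_mul_of_pos_left _ (by omega)
    nlinarith
  refine (length_encode_le_of_le hcard fun p hp => le_of_mem_honestFacts hid hp).trans
    (le_of_eq ?_)
  rw [certSize]
  ring

theorem isBigO_certSize (c : ℕ) : (fun n : ℕ => (certSize c n : ℝ)) =O[Filter.atTop]
    fun n : ℕ => (n : ℝ) ^ (3 / 2 : ℝ) * Real.log n ^ 2 := by
  refine Asymptotics.IsBigO.of_bound (16 * (37 * (8 * c + 44))) ?_
  filter_upwards [Filter.eventually_ge_atTop 2] with n hn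
  have hn0 : (0 : ℝ) < n := by positivity
  have hlog : 0 ≤ Real.log n := Real.log_natCast_nonneg n
  rw [Real.norm_of_nonneg (by positivity), Real.norm_of_nonneg (by positivity)]
  have h1 : ((Nat.log 2 n + 1 : ℕ) : ℝ) ≤ 4 * Real.log n := by
    have hp : 1 ≤ Nat.log 2 n := Nat.log_pos one_lt_two hn
    have h2 : (2 : ℝ) ^ Nat.log 2 n ≤ n := by exact_mod_cast Nat.pow_log_le_self 2 (by omega)
    have h3 := Real.log_le_log (by positivity) h2
    rw [Real.log_pow] at h3
    have h4 : (1 / 2 : ℝ) ≤ Real.log 2 := by linarith [Real.log_two_gt_d9]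
    have h5 : (1 : ℝ) ≤ Nat.log 2 n := by exact_mod_cast hp
    push_cast
    nlinarith
  have h2 : (Nat.sqrt n : ℝ) ≤ Real.sqrt n := Real.nat_sqrt_le_real_sqrt
  have h3 : (n : ℝ) ^ (3 / 2 : ℝ) = Real.sqrt n * n := by
    rw [show (3 / 2 : ℝ) = 1 / 2 + 1 by norm_num, Real.rpow_add hn0, Real.rpow_one,
      Real.sqrt_eq_rpow]
  rw [h3]
  have h4 : ((Nat.log 2 n + 1 : ℕ) : ℝ) ^ 2 ≤ (4 * Real.log n) ^ 2 := by gcongr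
  calc (certSize c n : ℝ)
      = 37 * (8 * c + 44) * ((Nat.log 2 n + 1 : ℕ) : ℝ) ^ 2 * Nat.sqrt n * n := by
        rw [certSize]
        push_cast
        ring
    _ ≤ 37 * (8 * c + 44) * (4 * Real.log n) ^ 2 * Real.sqrt n * n := by gcongr
    _ = _ := by ring

end Size

/-! ### The local certification -/

theorem isIndContained_pathGraph_iff {V : Type} {G : SimpleGraph V} {t : ℕ} (ht : 0 < t) :
    (SimpleGraph.pathGraph t).IsIndContained G ↔ ∃ y : ℕ → V, IsInducedPath G.Adj t y := by
  constructor
  · rintro ⟨f⟩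
    refine ⟨fun i => if h : i < t then f ⟨i, h⟩ else f ⟨0, ht⟩, fun i j hij hj => ?_⟩
    have hi : i < t := hij.trans hj
    simp only [hi, hj, dif_pos]
    rw [f.map_adj_iff, SimpleGraph.pathGraph_adj, ne_eq, f.injective.eq_iff, Fin.mk.injEq]
    simp only
    omega
  · rintro ⟨y, hy⟩
    refine ⟨⟨⟨fun i => y i, fun i j hij => ?_⟩, fun {i j} => ?_⟩⟩
    · by_contra hne
      rcases lt_or_gt_of_ne hne with h | h
      · exact (hy i j h j.2).1 hij
      · exact (hy j i h i.2).1 hij.symm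
    · change G.Adj (y i) (y j) ↔ _
      rw [SimpleGraph.pathGraph_adj]
      rcases lt_trichotomy i j with h | rfl | h
      · rw [(hy i j h j.2).2]
        omega
      · simp
      · rw [G.adj_comm, (hy j i h i.2).2]
        omega

/-! ### Views as edge and certificate relations -/

namespace LocalView

def Edge (W : LocalView) (a b : ℕ) : Prop := (a, b) ∈ W.edges

def Certified (W : LocalView) (a : ℕ) (F : FactSet) : Prop :=
  ∃ l, (a, l) ∈ W.labels ∧ F = decode l

end LocalView

section View

variable {V : Type} {G : SimpleGraph V} {ident : V → ℕ} {cert : V → List Bool} {d : ℕ}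

theorem edge_localView_center (hinj : Function.Injective ident) (hd : 1 ≤ d) (v : V) (b : ℕ) :
    (localView G ident cert d v).Edge (ident v) b ↔ ∃ w, G.Adj v w ∧ b = ident w := by
  constructor
  · rintro ⟨x, y, hxy, -, -, -, h⟩
    obtain ⟨h1, h2⟩ := Prod.mk.inj h
    exact ⟨y, hinj h1 ▸ hxy, h2⟩
  · rintro ⟨w, hw, rfl⟩
    refine ⟨v, w, hw, by simp, ?_, fun h => ?_, rfl⟩
    · rw [SimpleGraph.edist_eq_one_iff_adj.2 hw]
      exact_mod_cast hd
    · rw [SimpleGraph.edist_self] at h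
      have : (0 : ℕ) = d := by exact_mod_cast h.1
      omega

theorem certified_localView {v w : V} (h : G.edist v w ≤ d) :
    (localView G ident cert d v).Certified (ident w) (decode (cert w)) :=
  ⟨cert w, ⟨w, h, rfl⟩, rfl⟩

theorem exists_of_certified {v : V} {a : ℕ} {F : FactSet}
    (h : (localView G ident cert d v).Certified a F) :
    ∃ w, G.Reachable v w ∧ a = ident w ∧ F = decode (cert w) := by
  obtain ⟨l, ⟨w, hw, h⟩, rfl⟩ := h
  obtain ⟨h1, h2⟩ := Prod.mk.inj h
  exact ⟨w, SimpleGraph.edist_ne_top_iff_reachable.1 (ne_top_of_le_ne_top (ENat.natCast_ne_top d) hw),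
    h1, by rw [h2]⟩

theorem sees_localView (hinj : Function.Injective ident) (hd : 1 ≤ d) :
    Sees G ident (fun v => decode (cert v)) (fun v => (localView G ident cert d v).Edge)
      (fun v => (localView G ident cert d v).Certified) where
  inj := hinj
  edge := edge_localView_center hinj hd
  of_edge := by
    rintro v a b ⟨x, y, hxy, hx, -, -, h⟩
    obtain ⟨h1, h2⟩ := Prod.mk.inj h
    exact ⟨x, y, hxy, SimpleGraph.edist_ne_top_iff_reachable.1
      (ne_top_of_le_ne_top (ENat.natCast_ne_top d) hx), h1, h2⟩
  of_label := fun v a F h => exists_of_certified h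
  label_adj := fun v w h => certified_localView (by
    rw [SimpleGraph.edist_eq_one_iff_adj.2 h]
    exact_mod_cast hd)

/-- At radius κ + 1 only edges between two vertices at distance exactly κ + 1 are hidden, so every
edge with an end within distance κ is visible. -/
theorem seesNear_localView (hinj : Function.Injective ident) (κ : ℕ) (v : V) :
    SeesNear G ident κ (fun v => decode (cert v)) v (localView G ident cert (κ + 1) v).Edge
      (localView G ident cert (κ + 1) v).Certified where
  edge := edge_localView_center hinj (Nat.succ_pos κ) v
  of_label := fun a F h => by
    obtain ⟨w, -, h⟩ := exists_of_certified h
    exact ⟨w, h⟩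
  edge_near := fun u w hu huw => by
    have hw : G.edist v w ≤ ((κ + 1 : ℕ) : ℕ∞) := by
      refine (SimpleGraph.edist_triangle (v := u)).trans ?_
      rw [SimpleGraph.edist_eq_one_iff_adj.2 huw]
      push_cast
      gcongr
    have hlt : ((κ : ℕ) : ℕ∞) < ((κ + 1 : ℕ) : ℕ∞) := Nat.cast_lt.2 (Nat.lt_succ_self κ)
    exact ⟨⟨u, w, huw, hu.trans hlt.le, hw, fun h => (hu.trans_lt hlt).ne h.1, rfl⟩,
      certified_localView hw⟩
  label_near := fun u hu => certified_localView (hu.trans (by exact_mod_cast Nat.le_succ κ))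

end View

theorem hasLocalCertification_of_two_le (c κ : ℕ) (hκ : 1 ≤ κ) :
    HasLocalCertification c (certSize c) (κ + 1) (IsInducedPathFree (4 * (κ + 1) - 1)) := by
  classical
  refine ⟨fun W => decide (∃ F, W.Certified W.center F ∧
    Accepts (κ + 1) W.center W.Edge W.Certified F.common), fun V _ G ident hid => ⟨?_, ?_⟩⟩
  · intro hP
    have hfree : ∀ y : ℕ → V, ¬ IsInducedPath G.Adj (4 * (κ + 1) - 1) y := fun y hy =>
      hP ((isIndContained_pathGraph_iff (by omega)).2 ⟨y, hy⟩)
    obtain ⟨cl, hcl⟩ := exists_balanced_coloring V (colorCount_pos (Fintype.card V))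
    obtain ⟨φ, hφ⟩ := exists_coloring_surjOn (colorCount_pos (Fintype.card V))
      (Finset.univ.filter fun u : V => IsHigh G (Nat.sqrt (Fintype.card V)) u)
      (fun u => (G.neighborSet u).toFinite.toFinset)
      (fun u hu => by
        rw [← Set.ncard_eq_toFinset_card]
        exact (Finset.mem_filter.1 hu).2)
      (mul_colorCount_mul_pow_lt (Fintype.card V))
    refine ⟨fun w => encode (honestFacts G ident (Nat.sqrt (Fintype.card V)) κ φ cl w),
      length_encode_honestFacts_le (fun u => (hid.2 u).2) hcl hκ, fun v => ?_⟩
    have hS := seesNear_localView (G := G) (cert := fun w =>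
      encode (honestFacts G ident (Nat.sqrt (Fintype.card V)) κ φ cl w)) hid.1 κ v
    simp only [decode_encode] at hS
    refine decide_eq_true ⟨_, hS.label_near v (by simp), ?_⟩
    rw [common_honestFacts]
    exact hS.accepts hid.1 (fun u => (hid.2 u).1)
      (fun u hu i => by simpa using hφ u (by simpa using hu) i) hκ hfree
  · intro hP cert
    by_contra! hcon
    rw [IsInducedPathFree, not_not, isIndContained_pathGraph_iff (by omega)] at hP
    obtain ⟨y, hy⟩ := hP
    have hS := sees_localView (G := G) (cert := cert) hid.1 (Nat.succ_pos κ)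
    refine hS.not_isInducedPath (by omega) (fun v => ?_) y hy
    obtain ⟨F, hF, hA⟩ := of_decide_eq_true ((Bool.not_eq_false _).mp (hcon v))
    rwa [hS.eq_of_label hF] at hA

/-- Every vertex is given its closed neighbourhood; in a disjoint union of complete graphs,
adjacent vertices are given the same. -/
theorem hasLocalCertification_one (c : ℕ) :
    HasLocalCertification c (certSize c) 1 (IsInducedPathFree 3) := by
  classical
  refine ⟨fun W => decide (∃ F, W.Certified W.center F ∧
    (∀ w, (0, w, 0, 0) ∈ F ↔ w = W.center ∨ W.Edge W.center w) ∧
    ∀ w F', W.Edge W.center w → W.Certified w F' → F' = F), fun V _ G ident hid => ⟨?_, ?_⟩⟩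
  · intro hP
    have hfree : ∀ y : ℕ → V, ¬ IsInducedPath G.Adj 3 y := fun y hy =>
      hP ((isIndContained_pathGraph_iff (by omega)).2 ⟨y, hy⟩)
    have htrans : ∀ a b d, G.Adj a b → G.Adj b d → a = d ∨ G.Adj a d := by
      intro a b d hab hbd
      by_contra! hcon
      refine hfree (fun i => if i = 0 then a else if i = 1 then b else d) fun i j hij hj => ?_
      obtain ⟨rfl, rfl⟩ | ⟨rfl, rfl⟩ | ⟨rfl, rfl⟩ :
          (i = 0 ∧ j = 1) ∨ (i = 0 ∧ j = 2) ∨ (i = 1 ∧ j = 2) := by omega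
      · simp [hab, hab.ne]
      · simp [hcon]
      · simp [hbd, hbd.ne]
    let N : V → FactSet := fun v =>
      (Finset.univ.filter fun w => w = v ∨ G.Adj v w).image fun w => (0, ident w, 0, 0)
    have hmem : ∀ v b, (0, b, 0, 0) ∈ N v ↔ b = ident v ∨ ∃ w, G.Adj v w ∧ b = ident w := by
      intro v b
      simp only [N, Finset.mem_image, Finset.mem_filter, Finset.mem_univ, true_and, Prod.mk.injEq,
        and_true]
      constructor
      · rintro ⟨w, rfl | h, rfl⟩
        exacts [Or.inl rfl, Or.inr ⟨w, h, rfl⟩]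
      · rintro (rfl | ⟨w, h, rfl⟩)
        exacts [⟨v, Or.inl rfl, rfl⟩, ⟨w, Or.inr h, rfl⟩]
    have hN : ∀ v w, G.Adj v w → N w = N v := by
      intro v w hvw
      have : ∀ x, (x = w ∨ G.Adj w x) ↔ (x = v ∨ G.Adj v x) := fun x => by
        constructor
        · rintro (rfl | h)
          · exact Or.inr hvw
          · exact (htrans v w x hvw h).imp Eq.symm id
        · rintro (rfl | h)
          · exact Or.inr hvw.symm
          · exact (htrans w v x hvw.symm h).imp Eq.symm id
      simp only [N, this]
    refine ⟨fun v => encode (N v), fun v => ?_, fun v => ?_⟩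
    · have hcard : (N v).card ≤ Fintype.card V :=
        Finset.card_image_le.trans (Finset.card_le_univ _)
      refine (length_encode_le_of_le (c := c) (n := Fintype.card V) hcard fun p hp => ?_).trans ?_
      · obtain ⟨u, -, rfl⟩ := Finset.mem_image.1 hp
        have := (hid.2 u).2
        refine ⟨?_, ?_, ?_, ?_⟩ <;> dsimp only <;> omega
      · have hq : 0 < Nat.sqrt (Fintype.card V) :=
          Nat.sqrt_pos.2 (Fintype.card_pos_iff.2 ⟨v⟩)
        calc Fintype.card V * ((8 * c + 44) * (Nat.log 2 (Fintype.card V) + 1))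
            ≤ Fintype.card V * ((8 * c + 44) * (Nat.log 2 (Fintype.card V) + 1)) *
              (37 * (Nat.log 2 (Fintype.card V) + 1) * Nat.sqrt (Fintype.card V)) :=
              Nat.le_mul_of_pos_right _ (by positivity)
          _ = _ := by rw [certSize]; ring
    · have hS := seesNear_localView (G := G) (cert := fun v => encode (N v)) hid.1 0 v
      simp only [decode_encode] at hS
      refine decide_eq_true ⟨_, hS.label_near v (by simp), fun b => ?_, fun b F' hE hL => ?_⟩
      · exact (hmem v b).trans (or_congr Iff.rfl (hS.edge b).symm)
      · obtain ⟨w, hw, rfl⟩ := (hS.edge b).1 hE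
        rw [hS.eq_of_label hid.1 hL]
        exact hN v w hw
  · intro hP cert
    by_contra! hcon
    rw [IsInducedPathFree, not_not, isIndContained_pathGraph_iff (by omega)] at hP
    obtain ⟨y, hy⟩ := hP
    have hS := sees_localView (G := G) (cert := cert) hid.1 le_rfl
    have hA : ∀ v, (∀ b, (0, b, 0, 0) ∈ decode (cert v) ↔
        b = ident v ∨ ∃ w, G.Adj v w ∧ b = ident w) ∧
        ∀ w, G.Adj v w → decode (cert w) = decode (cert v) := by
      intro v
      obtain ⟨F, hF, h1, h2⟩ := of_decide_eq_true ((Bool.not_eq_false _).mp (hcon v))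
      obtain rfl := hS.eq_of_label hF
      exact ⟨fun b => (h1 b).trans (or_congr Iff.rfl (hS.edge v b)), fun w hw =>
        h2 _ _ ((hS.edge v _).2 ⟨w, hw, rfl⟩) (hS.label_adj v w hw)⟩
    have h01 := (hy 0 1 (by omega) (by omega)).2.2 rfl
    have h12 := (hy 1 2 (by omega) (by omega)).2.2 rfl
    have h02 := hy 0 2 (by omega) (by omega)
    -- The list of y 1 contains y 2 and equals the list of y 0, so y 2 would be y 0 or a neighbour
    -- of it.
    have h := ((hA (y 1)).1 (ident (y 2))).2 (Or.inr ⟨_, h12, rfl⟩)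
    rw [(hA (y 0)).2 _ h01, (hA (y 0)).1] at h
    rcases h with h | ⟨w, hw, h⟩
    · exact h02.1 (hid.1 h).symm
    · have := h02.2.1 (hid.1 h ▸ hw)
      omega

theorem mainTheorem5 (c : ℕ) :
    ∃ s : ℕ → ℕ,
      ((fun n : ℕ => (s n : ℝ)) =O[Filter.atTop]
        fun n : ℕ => (n : ℝ) ^ (3 / 2 : ℝ) * Real.log n ^ 2) ∧
      ∀ k : ℕ, 1 ≤ k → HasLocalCertification c s k (IsInducedPathFree (4 * k - 1)) := by
  refine ⟨certSize c, isBigO_certSize c, fun k hk => ?_⟩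
  rcases hk.eq_or_lt with rfl | hk
  · exact hasLocalCertification_one c
  · obtain ⟨κ, rfl⟩ : ∃ κ, k = κ + 1 := ⟨k - 1, by omega⟩
    exact hasLocalCertification_of_two_le c κ (by omega)
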